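/- Let $d\in\mathbb{N}$. Let $\rho\in\mathcal{S}(\mathbb{R}^d)$ be even with $\int\rho(x)\,dx=1$ and $\int x^m\rho(x)\,dx=0$ for all $m\in\mathbb{N}^d\setminus\{0\}$, and let $\chi\in\mathcal{D}(\mathbb{R}^d)$ satisfy $0\le\chi\le1$, $\chi\equiv1$ on $\overline{B(0,1)}$ and $\chi\equiv0$ on $\mathbb{R}^d\setminus B(0,2)$. For $\varepsilon\in(0,1)$ put $$\theta_\varepsilon(x)=\varepsilon^{-d}\rho(x/\varepsilon)\,\chi(x|\ln\varepsilon|),\qquad x\in\mathbb{R}^d .$$ Let $C^\infty(\mathbb{R}^d)$ be the algebra of complex valued smooth functions and, for compact $K\subset\mathbb{R}^d$ and $l\in\mathbb{N}$, let $p_{K,l}(f)=\sup_{x\in K,\,|\alpha|\le l}|\partial^\alpha f(x)|$. A net $(f_\varepsilon)_\varepsilon\in C^\infty(\mathbb{R}^d)^{(0,1]}$ is called moderate if for all $l$ and $K$ there is $q\in\mathbb{N}$ with $p_{K,l}(f_\varepsilon)=o(\varepsilon^{-q})$ as $\varepsilon\to0$, and negligible if for all $l$, $K$ and all $p\in\mathbb{N}$,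 $p_{K,l}(f_\varepsilon)=o(\varepsilon^{p})$ as $\varepsilon\to0$. Let $\mathcal{G}(\mathbb{R}^d)$ be the quotient of the algebra of moderate nets by the ideal of negligible nets, write $[(f_\varepsilon)_\varepsilon]$ for the class of a moderate net, and let $\sigma:C^\infty(\mathbb{R}^d)\to\mathcal{G}(\mathbb{R}^d)$, $\sigma(f)=[(f)_\varepsilon]$, be the constant embedding. For a complex valued distribution $T\in\mathcal{D}'(\mathbb{R}^d)$ and $0<\varepsilon<1$ put $(T*\theta_\varepsilon)(y)=\langle T,\theta_\varepsilon(y-\cdot)\rangle$. Then, for every $T\in\mathcal{D}'(\mathbb{R}^d)$, the net $(T*\theta_\varepsilon)_\varepsilon$, completed at $\varepsilon=1$ by an arbitrary smooth function, is a moderate net of smooth functions whose class in $\mathcal{G}(\mathbb{R}^d)$ does not depend on the function chosen at $\varepsilon=1$. The resulting map $$\iota_S:\mathcal{D}'(\mathbb{R}^d)\to\mathcal{G}(\mathbb{R}^d),\qquad T\mapsto[(T*\theta_\varepsilon)_\varepsilon],$$ is $\mathbb{C}$-linear and injective, and $\iota_S(f)=\sigma(f)$ for every $f\in C^\infty(\mathbb{R}^d)$,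 where $f$ is identified with the distribution $\varphi\mapsto\int f(x)\varphi(x)\,dx$. -/

import Mathlib

open Set Filter Topology MeasureTheory TopologicalSpace
open scoped Distributions SchwartzMap ContDiff

noncomputable section

namespace Colombeau

/-- The Euclidean space `ℝ^d`. -/
abbrev E (d : ℕ) : Type := EuclideanSpace ℝ (Fin d)

/-- The parameter set `(0, 1]` of the nets. -/
abbrev I01 : Type := Set.Ioc (0 : ℝ) 1

/-- The filter `ε → 0` on `(0, 1]`. -/
def toZero : Filter I01 := Filter.comap (fun ε : I01 => (ε : ℝ)) (𝓝 0)

/-- The algebra `C^∞(ℝ^d)` of complex valued smooth functions. -/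
def SmoothFun (d : ℕ) : Subalgebra ℂ (E d → ℂ) where
  carrier := {f | ContDiff ℝ ∞ f}
  mul_mem' := fun {f g} hf hg => by
    have hf : ContDiff ℝ ∞ f := hf
    have hg : ContDiff ℝ ∞ g := hg
    exact hf.mul hg
  add_mem' := fun {f g} hf hg => by
    have hf : ContDiff ℝ ∞ f := hf
    have hg : ContDiff ℝ ∞ g := hg
    exact hf.add hg
  algebraMap_mem' := fun c => by
    have h : ContDiff ℝ ∞ (fun _ : E d => c) := contDiff_const
    exact h

/-- The seminorm `p_{K,l}(f)`, the supremum over `x ∈ K` of all the derivatives of `f` of order at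
most `l`; the derivatives of order `k` are collected in the `k`-linear map `D^k f(x)`, whose norm
is equivalent to the maximum of the `|∂^α f(x)|` with `|α| = k`. -/
def pSemi {d : ℕ} (K : Compacts (E d)) (l : ℕ) (f : E d → ℂ) : ℝ :=
  ⨆ z : Fin (l + 1) × (K : Set (E d)), ‖iteratedFDeriv ℝ (z.1 : ℕ) f (z.2 : E d)‖

section pSemi

variable {d : ℕ} (K : Compacts (E d)) (l : ℕ) {f g : E d → ℂ}

theorem pSemi_nonneg (f : E d → ℂ) : 0 ≤ pSemi K l f :=
  Real.iSup_nonneg fun _ => norm_nonneg _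

theorem pSemi_bddAbove (hf : ContDiff ℝ ∞ f) :
    BddAbove (Set.range fun z : Fin (l + 1) × (K : Set (E d)) =>
      ‖iteratedFDeriv ℝ (z.1 : ℕ) f (z.2 : E d)‖) := by
  have : CompactSpace (K : Set (E d)) := isCompact_iff_compactSpace.1 K.isCompact
  refine (isCompact_range ?_).bddAbove
  refine continuous_prod_of_discrete_left.2 fun k => ?_
  exact ((hf.continuous_iteratedFDeriv (m := (k : ℕ)) (by exact_mod_cast le_top)).comp
    continuous_subtype_val).norm

theorem le_pSemi (hf : ContDiff ℝ ∞ f) {k : ℕ} (hk : k ≤ l) {x : E d} (hx : x ∈ K) :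
    ‖iteratedFDeriv ℝ k f x‖ ≤ pSemi K l f :=
  le_ciSup (pSemi_bddAbove K l hf) (⟨⟨k, Nat.lt_succ_of_le hk⟩, ⟨x, hx⟩⟩ :
    Fin (l + 1) × (K : Set (E d)))

theorem pSemi_le {C : ℝ} (hC : 0 ≤ C)
    (h : ∀ k ≤ l, ∀ x ∈ K, ‖iteratedFDeriv ℝ k f x‖ ≤ C) : pSemi K l f ≤ C :=
  Real.iSup_le (fun z => h z.1 (Nat.le_of_lt_succ z.1.2) z.2 z.2.2) hC

theorem pSemi_add (hf : ContDiff ℝ ∞ f) (hg : ContDiff ℝ ∞ g) :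
    pSemi K l (f + g) ≤ pSemi K l f + pSemi K l g := by
  refine pSemi_le K l (add_nonneg (pSemi_nonneg K l f) (pSemi_nonneg K l g)) fun k hk x hx => ?_
  have hk' : ((k : ℕ) : WithTop ℕ∞) ≤ ∞ := by exact_mod_cast le_top
  have : iteratedFDeriv ℝ k (f + g) x = iteratedFDeriv ℝ k f x + iteratedFDeriv ℝ k g x :=
    iteratedFDeriv_add_apply (hf.of_le hk').contDiffAt (hg.of_le hk').contDiffAt
  rw [this]
  exact (norm_add_le _ _).trans (add_le_add (le_pSemi K l hf hk hx) (le_pSemi K l hg hk hx))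

theorem pSemi_mul (hf : ContDiff ℝ ∞ f) (hg : ContDiff ℝ ∞ g) :
    pSemi K l (f * g) ≤ 2 ^ l * (pSemi K l f * pSemi K l g) := by
  have h0 := mul_nonneg (pSemi_nonneg K l f) (pSemi_nonneg K l g)
  refine pSemi_le K l (mul_nonneg (by positivity) h0) fun k hk x hx => ?_
  have hk' : ((k : ℕ) : WithTop ℕ∞) ≤ ∞ := by exact_mod_cast le_top
  calc ‖iteratedFDeriv ℝ k (f * g) x‖
      ≤ ∑ i ∈ Finset.range (k + 1), (k.choose i : ℝ) *
          ‖iteratedFDeriv ℝ i f x‖ * ‖iteratedFDeriv ℝ (k - i) g x‖ :=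
        norm_iteratedFDeriv_mul_le hf hg x hk'
    _ ≤ ∑ i ∈ Finset.range (k + 1), (k.choose i : ℝ) * (pSemi K l f * pSemi K l g) := by
        refine Finset.sum_le_sum fun i hi => ?_
        have hi' : i ≤ k := Nat.le_of_lt_succ (Finset.mem_range.1 hi)
        rw [mul_assoc]
        refine mul_le_mul_of_nonneg_left ?_ (Nat.cast_nonneg _)
        exact mul_le_mul (le_pSemi K l hf (hi'.trans hk) hx)
          (le_pSemi K l hg ((Nat.sub_le _ _).trans hk) hx) (norm_nonneg _) (pSemi_nonneg K l f)
    _ = 2 ^ k * (pSemi K l f * pSemi K l g) := by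
        rw [← Finset.sum_mul]
        congr 1
        exact_mod_cast Nat.sum_range_choose k
    _ ≤ 2 ^ l * (pSemi K l f * pSemi K l g) :=
        mul_le_mul_of_nonneg_right (pow_le_pow_right₀ (by norm_num) hk) h0

end pSemi

/-- Families of functions on `ℝ^d` indexed by `(0, 1]`. -/
abbrev Net (d : ℕ) : Type := I01 → E d → ℂ

/-- `(f_ε)_ε` is a net of smooth functions that is moderate. -/
def IsModerate {d : ℕ} (u : Net d) : Prop :=
  (∀ ε, ContDiff ℝ ∞ (u ε)) ∧
    ∀ (l : ℕ) (K : Compacts (E d)), ∃ q : ℕ,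
      (fun ε => pSemi K l (u ε)) =o[toZero] (fun ε : I01 => ((ε : ℝ) ^ q)⁻¹)

/-- `(f_ε)_ε` is a net of smooth functions that is negligible. -/
def IsNegligible {d : ℕ} (u : Net d) : Prop :=
  (∀ ε, ContDiff ℝ ∞ (u ε)) ∧
    ∀ (l : ℕ) (K : Compacts (E d)), ∀ p : ℕ,
      (fun ε => pSemi K l (u ε)) =o[toZero] (fun ε : I01 => (ε : ℝ) ^ p)

section closure

open Asymptotics

variable {d : ℕ}

theorem isLittleO_of_le {a b g : I01 → ℝ} (C : ℝ) (ha : ∀ ε, 0 ≤ a ε) (h : ∀ ε, a ε ≤ C * b ε)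
    (hb : b =o[toZero] g) : a =o[toZero] g := by
  refine IsBigO.trans_isLittleO ?_ hb
  refine IsBigO.of_bound |C| (Eventually.of_forall fun ε => ?_)
  rw [Real.norm_eq_abs, Real.norm_eq_abs, abs_of_nonneg (ha ε), ← abs_mul]
  exact (h ε).trans (le_abs_self _)

theorem isModerate_const {f : E d → ℂ} (hf : ContDiff ℝ ∞ f) : IsModerate (fun _ => f) := by
  refine ⟨fun _ => hf, fun l K => ⟨1, ?_⟩⟩
  have h : Tendsto (fun ε : I01 => (ε : ℝ)) toZero (𝓝 0) := tendsto_comap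
  rw [isLittleO_iff_tendsto']
  · simpa using h.const_mul (pSemi K l f)
  · exact Eventually.of_forall fun ε h0 => absurd h0 (by simpa using ε.2.1.ne')

theorem inv_pow_isBigO {q r : ℕ} (h : q ≤ r) :
    (fun ε : I01 => ((ε : ℝ) ^ q)⁻¹) =O[toZero] (fun ε : I01 => ((ε : ℝ) ^ r)⁻¹) := by
  refine IsBigO.of_bound 1 (Eventually.of_forall fun ε => ?_)
  have h0 := ε.2.1
  rw [one_mul, Real.norm_of_nonneg (by positivity), Real.norm_of_nonneg (by positivity)]
  exact inv_anti₀ (pow_pos h0 r) (pow_le_pow_of_le_one h0.le ε.2.2 h)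

theorem IsModerate.add {u v : Net d} (hu : IsModerate u) (hv : IsModerate v) :
    IsModerate (u + v) := by
  refine ⟨fun ε => (hu.1 ε).add (hv.1 ε), fun l K => ?_⟩
  obtain ⟨q, hq⟩ := hu.2 l K
  obtain ⟨r, hr⟩ := hv.2 l K
  refine ⟨max q r, isLittleO_of_le 1 (fun ε => pSemi_nonneg K l _) (fun ε => ?_)
    ((hq.trans_isBigO (inv_pow_isBigO (le_max_left q r))).add
      (hr.trans_isBigO (inv_pow_isBigO (le_max_right q r))))⟩
  rw [one_mul]
  exact pSemi_add K l (hu.1 ε) (hv.1 ε)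

theorem IsModerate.mul {u v : Net d} (hu : IsModerate u) (hv : IsModerate v) :
    IsModerate (u * v) := by
  refine ⟨fun ε => (hu.1 ε).mul (hv.1 ε), fun l K => ?_⟩
  obtain ⟨q, hq⟩ := hu.2 l K
  obtain ⟨r, hr⟩ := hv.2 l K
  refine ⟨q + r, isLittleO_of_le (2 ^ l) (fun ε => pSemi_nonneg K l _)
    (fun ε => pSemi_mul K l (hu.1 ε) (hv.1 ε)) ?_⟩
  refine (hq.mul hr).congr_right fun ε => ?_
  rw [pow_add, mul_inv]

theorem IsNegligible.add {u v : Net d} (hu : IsNegligible u) (hv : IsNegligible v) :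
    IsNegligible (u + v) := by
  refine ⟨fun ε => (hu.1 ε).add (hv.1 ε), fun l K p => ?_⟩
  refine isLittleO_of_le 1 (fun ε => pSemi_nonneg K l _) (fun ε => ?_)
    ((hu.2 l K p).add (hv.2 l K p))
  rw [one_mul]
  exact pSemi_add K l (hu.1 ε) (hv.1 ε)

theorem isNegligible_zero : IsNegligible (0 : Net d) := by
  refine ⟨fun _ => contDiff_const, fun l K p => ?_⟩
  have h : (fun ε => pSemi K l ((0 : Net d) ε)) = fun _ => (0 : ℝ) := by
    funext ε
    refine le_antisymm (pSemi_le K l le_rfl fun k _ x _ => ?_) (pSemi_nonneg K l _)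
    have h0 : (0 : Net d) ε = 0 := rfl
    rw [h0, iteratedFDeriv_zero]
    simp
  rw [h]
  exact isLittleO_zero _ _

theorem IsModerate.mul_isNegligible {u v : Net d} (hu : IsModerate u) (hv : IsNegligible v) :
    IsNegligible (u * v) := by
  refine ⟨fun ε => (hu.1 ε).mul (hv.1 ε), fun l K p => ?_⟩
  obtain ⟨q, hq⟩ := hu.2 l K
  refine isLittleO_of_le (2 ^ l) (fun ε => pSemi_nonneg K l _)
    (fun ε => pSemi_mul K l (hu.1 ε) (hv.1 ε)) ?_
  refine (hq.mul (hv.2 l K (q + p))).congr_right fun ε => ?_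
  have h0 : (ε : ℝ) ^ q ≠ 0 := pow_ne_zero _ ε.2.1.ne'
  rw [pow_add, inv_mul_cancel_left₀ h0]

end closure

/-- The algebra `F(C^∞(ℝ^d))` of moderate nets. -/
def Moderate (d : ℕ) : Subalgebra ℂ (Net d) where
  carrier := {u | IsModerate u}
  mul_mem' := IsModerate.mul
  add_mem' := IsModerate.add
  algebraMap_mem' := fun c => isModerate_const (f := fun _ => c) contDiff_const

/-- The ideal `N(C^∞(ℝ^d))` of negligible nets in the algebra of moderate nets. -/
def Negligible (d : ℕ) : Ideal (Moderate d) where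
  carrier := {u | IsNegligible (u : Net d)}
  add_mem' := IsNegligible.add
  zero_mem' := isNegligible_zero
  smul_mem' := fun u _ hv => IsModerate.mul_isNegligible u.2 hv

/-- Every negligible net is moderate, so that nothing is lost by taking `N` inside `F`. -/
theorem IsNegligible.isModerate {d : ℕ} {u : Net d} (hu : IsNegligible u) : IsModerate u :=
  ⟨hu.1, fun l K => ⟨0, by simpa using hu.2 l K 0⟩⟩

/-- The simplified Colombeau algebra `G(ℝ^d) = F(C^∞(ℝ^d)) / N(C^∞(ℝ^d))`. -/
abbrev G (d : ℕ) : Type := Moderate d ⧸ Negligible d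

/-- The class in `G(ℝ^d)` of a moderate net. -/
def G.mk {d : ℕ} (u : Net d) (hu : u ∈ Moderate d) : G d :=
  Ideal.Quotient.mk (Negligible d) ⟨u, hu⟩

/-- The constant embedding `σ : C^∞(ℝ^d) → G(ℝ^d)`, `f ↦ [(f)_ε]`. -/
def sigma {d : ℕ} (f : SmoothFun d) : G d :=
  G.mk (fun _ => (f : E d → ℂ)) (isModerate_const f.2)

/-- Complex valued test functions on `ℝ^d`. -/
abbrev Test (d : ℕ) : Type := 𝓓((⊤ : Opens (E d)), ℂ)

/-- The space `D'(ℝ^d)` of complex valued distributions: the continuous linear forms on the space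
of test functions. -/
abbrev Distr (d : ℕ) : Type := Test d →L[ℂ] ℂ

/-- The distribution `φ ↦ ∫ φ f` defined by a smooth function `f`. -/
def ofSmooth {d : ℕ} (f : SmoothFun d) : Distr d :=
  TestFunction.integralAgainstBilinCLM (ContinuousLinearMap.mul ℂ ℂ) volume (f : E d → ℂ)

theorem ofSmooth_apply {d : ℕ} (f : SmoothFun d) (φ : Test d) :
    ofSmooth f φ = ∫ x, φ x * (f : E d → ℂ) x := by
  have hf : ContDiff ℝ ∞ (f : E d → ℂ) := f.2
  exact TestFunction.integralAgainstBilinCLM_eq_integral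
    (hf.continuous.locallyIntegrable.locallyIntegrableOn _)

/-- The test function `x ↦ θ (y - x)`. -/
def reflect {d : ℕ} (θ : Test d) (y : E d) : Test d where
  toFun := fun x => θ (y - x)
  contDiff' := θ.contDiff.comp (contDiff_const.sub contDiff_id)
  hasCompactSupport' := θ.hasCompactSupport.comp_homeomorph (Homeomorph.subLeft y)
  tsupport_subset' := fun _ _ => trivial

/-- The convolution `(T ∗ θ)(y) = ⟨T, x ↦ θ (y - x)⟩`. -/
def conv {d : ℕ} (T : Distr d) (θ : Test d) (y : E d) : ℂ := T (reflect θ y)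

/-- The test function `θ_ε (x) = ε^(-d) ρ(x / ε) χ(x |ln ε|)`, for `0 < ε < 1`. -/
def theta {d : ℕ} (ρ : 𝓢(E d, ℂ)) (χ : 𝓓((⊤ : Opens (E d)), ℝ)) (ε : Set.Ioo (0 : ℝ) 1) :
    Test d where
  toFun := fun x =>
    (((ε : ℝ) ^ d)⁻¹ : ℝ) * ρ ((ε : ℝ)⁻¹ • x) * (χ (|Real.log ε| • x) : ℂ)
  contDiff' := by
    have h1 : ContDiff ℝ ∞ fun x : E d => ρ ((ε : ℝ)⁻¹ • x) :=
      (ρ.smooth ⊤).comp (contDiff_const_smul _)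
    have h2 : ContDiff ℝ ∞ fun x : E d => (χ (|Real.log ε| • x) : ℂ) :=
      Complex.ofRealCLM.contDiff.comp (χ.contDiff.comp (contDiff_const_smul _))
    exact (contDiff_const.mul h1).mul h2
  hasCompactSupport' := by
    have hc : |Real.log ε| ≠ 0 := abs_ne_zero.2 (Real.log_neg ε.2.1 ε.2.2).ne
    have h := χ.hasCompactSupport.comp_homeomorph (Homeomorph.smulOfNeZero (α := E d) _ hc)
    have h' : HasCompactSupport fun x : E d => (χ (|Real.log ε| • x) : ℂ) :=
      HasCompactSupport.comp_left (g := fun t : ℝ => (t : ℂ)) h Complex.ofReal_zero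
    exact h'.mul_left
  tsupport_subset' := fun _ _ => trivial

end Colombeau

end

/-!
On test functions supported in a compact set, a distribution `T` is `L ∘ jets` for a continuous
linear form `L` on a space of bounded continuous jets of finite order (continuity and Hahn-Banach).
Since `y ↦ θ (y - ·)` is smooth into that Banach space, `T ∗ θ` is smooth, with derivatives bounded
by those of `θ`, and those of `θ_ε` are bounded by powers of `ε⁻¹`: this is moderateness.

In `(θ_ε ∗ G)(y) = ∫ ρ(z) χ(ε |log ε| z) G(y - ε z) dz` the moments of `ρ` kill the Taylor
polynomial of `G` at `y`, apart from its constant term, so that `θ_ε ∗ G - G = O(ε ^ (n + 1))` for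
every `n`; the error due to the cut-off is as small, because `(ε |log ε|) ^ 2 ≤ 4 ε` and `ρ` decays
rapidly. Applied to the derivatives of a smooth function this gives `ι_S = σ`.

For injectivity, `L` commutes with the integral in
`∫ φ (T ∗ θ_ε) = L (∫ φ(y) jets (θ_ε(y - ·)) dy)`, and the argument on the right converges to
`jets φ` by the same estimate. Hence `T ∗ θ_ε → T` weakly, while a negligible net tends to `0`.
-/

noncomputable section

namespace Colombeau

open scoped BoundedContinuousFunction

set_option maxSynthPendingDepth 3

universe u

theorem norm_iteratedFDeriv_iteratedFDeriv {V W : Type*} [NormedAddCommGroup V] [NormedSpace ℝ V]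
    [NormedAddCommGroup W] [NormedSpace ℝ W] (f : V → W) (x : V) (n k : ℕ) :
    ‖iteratedFDeriv ℝ n (iteratedFDeriv ℝ k f) x‖ = ‖iteratedFDeriv ℝ (n + k) f x‖ := by
  induction k generalizing n with
  | zero =>
    rw [iteratedFDeriv_zero_eq_comp, LinearIsometryEquiv.norm_iteratedFDeriv_comp_left, add_zero]
  | succ k ih =>
    have hcurry : iteratedFDeriv ℝ (k + 1) f =
        (continuousMultilinearCurryLeftEquiv ℝ (fun _ : Fin (k + 1) => V) W).symm ∘
          fderiv ℝ (iteratedFDeriv ℝ k f) := iteratedFDeriv_succ_eq_comp_left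
    rw [hcurry, LinearIsometryEquiv.norm_iteratedFDeriv_comp_left, norm_iteratedFDeriv_fderiv, ih,
      add_assoc, add_comm 1 k]

theorem norm_iteratedFDeriv_pi_le {ι V : Type*} [Fintype ι] {F : ι → Type*}
    [NormedAddCommGroup V] [NormedSpace ℝ V] [∀ i, NormedAddCommGroup (F i)]
    [∀ i, NormedSpace ℝ (F i)] {f : V → ∀ i, F i} {n : ℕ} (hf : ContDiff ℝ n f) {M : ℝ}
    (hM : 0 ≤ M) {x : V} (h : ∀ i, ‖iteratedFDeriv ℝ n (fun y => f y i) x‖ ≤ M) :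
    ‖iteratedFDeriv ℝ n f x‖ ≤ M := by
  refine ContinuousMultilinearMap.opNorm_le_bound hM fun m => (pi_norm_le_iff_of_nonneg ?_).2 ?_
  · positivity
  intro i
  have hi : iteratedFDeriv ℝ n (fun y => f y i) x m = iteratedFDeriv ℝ n f x m i :=
    congrArg (fun A : V [×n]→L[ℝ] F i => A m)
      ((ContinuousLinearMap.proj (R := ℝ) (φ := F) i).iteratedFDeriv_comp_left
        hf.contDiffAt le_rfl)
  rw [← hi]
  exact ContinuousMultilinearMap.le_of_opNorm_le (h i) m

section Translates

variable {V W : Type u} [NormedAddCommGroup V] [NormedSpace ℝ V] [NormedAddCommGroup W]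
  [NormedSpace ℝ W]

/-- The reflected translate `x ↦ g (y - x)`, in the Banach space of bounded continuous functions:
smoothness of convolutions is derived from that of the map `y ↦ shift g y`. -/
def shift (g : 𝓓((⊤ : Opens V), W)) (y : V) : V →ᵇ W :=
  (g : V →ᵇ W).compContinuous ⟨fun x => y - x, by fun_prop⟩

@[simp]
theorem shift_apply (g : 𝓓((⊤ : Opens V), W)) (y x : V) : shift g y x = g (y - x) := rfl

variable (V W) in
/-- Evaluation of bounded families of linear maps, `b ↦ v ↦ (x ↦ b x v)`. -/
def evalBounded : (V →ᵇ (V →L[ℝ] W)) →L[ℝ] V →L[ℝ] (V →ᵇ W) :=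
  LinearMap.mkContinuous₂
    (LinearMap.mk₂ ℝ
      (fun b v => (ContinuousLinearMap.apply ℝ W v).compLeftContinuousBounded V b)
      (fun _ _ _ => rfl) (fun _ _ _ => rfl)
      (fun b v w => BoundedContinuousFunction.ext fun x => map_add (b x) v w)
      (fun c b v => BoundedContinuousFunction.ext fun x => map_smul (b x) c v)) 1
    (fun b v => by
      rw [one_mul]
      exact (BoundedContinuousFunction.norm_le (by positivity)).2
        fun x => (b x).le_of_opNorm_le (b.norm_coe_le_norm x) v)

theorem norm_evalBounded_le : ‖evalBounded V W‖ ≤ 1 :=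
  LinearMap.mkContinuous₂_norm_le _ zero_le_one _

/-- The derivative of a test function, as a test function with values in the linear maps. -/
def fderivTest (g : 𝓓((⊤ : Opens V), W)) : 𝓓((⊤ : Opens V), V →L[ℝ] W) :=
  ⟨fderiv ℝ g, g.contDiff.fderiv_right (by simp), g.hasCompactSupport.fderiv ℝ,
    fun _ _ => trivial⟩

@[simp]
theorem coe_fderivTest (g : 𝓓((⊤ : Opens V), W)) : ⇑(fderivTest g) = fderiv ℝ g := rfl

theorem exists_norm_shift_add_sub_le (g : 𝓓((⊤ : Opens V), W)) :
    ∃ C : ℝ, ∀ y h, ‖shift g (y + h) - shift g y - evalBounded V W (shift (fderivTest g) y) h‖ ≤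
      C * ‖h‖ ^ 2 := by
  obtain ⟨C, hC⟩ := ContDiff.lipschitzWith_of_hasCompactSupport (fderivTest g).hasCompactSupport
    (fderivTest g).contDiff (by simp)
  refine ⟨C, fun y h => (BoundedContinuousFunction.norm_le (by positivity)).2 fun x => ?_⟩
  have hfderiv : ∀ z ∈ Metric.closedBall (y - x) ‖h‖,
      ‖fderiv ℝ g z - fderiv ℝ g (y - x)‖ ≤ C * ‖h‖ := fun z hz =>
    (dist_eq_norm (fderiv ℝ g z) _ ▸ hC.dist_le_mul z (y - x)).trans
      (mul_le_mul_of_nonneg_left hz C.2)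
  have hmvt := (convex_closedBall (y - x) ‖h‖).norm_image_sub_le_of_norm_fderiv_le'
    (fun z _ => (g.contDiff.differentiable (by simp)).differentiableAt) hfderiv
    (Metric.mem_closedBall_self (norm_nonneg h)) (y := y - x + h) (by simp [dist_eq_norm])
  rwa [add_sub_cancel_left, ← add_sub_right_comm, mul_assoc, ← sq] at hmvt

theorem hasFDerivAt_shift (g : 𝓓((⊤ : Opens V), W)) (y : V) :
    HasFDerivAt (shift g) (evalBounded V W (shift (fderivTest g) y)) y := by
  obtain ⟨C, hC⟩ := exists_norm_shift_add_sub_le g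
  rw [hasFDerivAt_iff_isLittleO_nhds_zero]
  refine Asymptotics.IsBigO.trans_isLittleO (g := fun h : V => ‖h‖ ^ 2) ?_ ?_
  · exact Asymptotics.IsBigO.of_bound C (Eventually.of_forall fun h => by simpa using hC y h)
  · simpa using Asymptotics.isLittleO_norm_pow_id (E' := V) one_lt_two

theorem contDiff_shift (g : 𝓓((⊤ : Opens V), W)) : ContDiff ℝ ∞ (shift g) := by
  refine contDiff_infty.2 fun n => ?_
  induction n generalizing W with
  | zero =>
    exact contDiff_zero.2 (continuous_iff_continuousAt.2 fun y =>
      (hasFDerivAt_shift g y).continuousAt)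
  | succ n ih =>
    exact contDiff_succ_iff_hasFDerivAt.2
      ⟨_, (evalBounded V W).contDiff.comp (ih (fderivTest g)), hasFDerivAt_shift g⟩

theorem norm_iteratedFDeriv_shift_le (g : 𝓓((⊤ : Opens V), W)) {n : ℕ} {M : ℝ} (hM : 0 ≤ M)
    (h : ∀ x, ‖iteratedFDeriv ℝ n g x‖ ≤ M) (y : V) :
    ‖iteratedFDeriv ℝ n (shift g) y‖ ≤ M := by
  induction n generalizing W with
  | zero =>
    rw [norm_iteratedFDeriv_zero, BoundedContinuousFunction.norm_le hM]
    exact fun x => by simpa using h (y - x)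
  | succ n ih =>
    have hd : fderiv ℝ (shift g) = evalBounded V W ∘ shift (fderivTest g) :=
      funext fun y => (hasFDerivAt_shift g y).fderiv
    rw [← norm_iteratedFDeriv_fderiv, hd]
    refine ((evalBounded V W).norm_iteratedFDeriv_comp_left
      (contDiff_shift (fderivTest g)).contDiffAt (by exact_mod_cast le_top)).trans ?_
    refine (mul_le_of_le_one_left (norm_nonneg _) norm_evalBounded_le).trans
      (ih (fderivTest g) fun x => ?_)
    rw [coe_fderivTest, norm_iteratedFDeriv_fderiv]
    exact h x

end Translates

section Jets

variable {d : ℕ}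

/-- The derivative of order `k` of a test function, as a vector valued test function. -/
def jet (k : ℕ) (φ : Test d) : 𝓓((⊤ : Opens (E d)), E d [×k]→L[ℝ] ℂ) :=
  ⟨iteratedFDeriv ℝ k φ, φ.contDiff.iteratedFDeriv_right (by norm_cast),
    φ.hasCompactSupport.iteratedFDeriv k, fun _ _ => trivial⟩

@[simp]
theorem coe_jet (k : ℕ) (φ : Test d) : ⇑(jet k φ) = iteratedFDeriv ℝ k φ := rfl

/-- The derivatives of order less than `N` of a test function, in a product of spaces of bounded
continuous functions; on this Banach space distributions are represented. -/
def jets (N : ℕ) (φ : Test d) : ∀ k : Fin N, E d →ᵇ E d [×(k : ℕ)]→L[ℝ] ℂ :=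
  fun k => jet k φ

@[simp]
theorem jets_apply (N : ℕ) (φ : Test d) (k : Fin N) (x : E d) :
    jets N φ k x = iteratedFDeriv ℝ k φ x := rfl

theorem exists_clm_eq_of_norm_le {V B : Type*} [AddCommGroup V] [Module ℂ V]
    [NormedAddCommGroup B] [NormedSpace ℂ B] (j : V →ₗ[ℂ] B) (T : V →ₗ[ℂ] ℂ) (C : ℝ)
    (h : ∀ v, ‖T v‖ ≤ C * ‖j v‖) : ∃ L : B →L[ℂ] ℂ, ∀ v, T v = L (j v) := by
  have hker : LinearMap.ker j ≤ LinearMap.ker T := fun v hv => by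
    have hTv := h v
    rw [LinearMap.mem_ker.1 hv, norm_zero, mul_zero] at hTv
    exact norm_le_zero_iff.1 hTv
  let S : LinearMap.range j →ₗ[ℂ] ℂ :=
    (LinearMap.ker j).liftQ T hker ∘ₗ j.quotKerEquivRange.symm.toLinearMap
  have hS : ∀ v, S ⟨j v, v, rfl⟩ = T v := fun v => by
    have hmk : j.quotKerEquivRange.symm ⟨j v, v, rfl⟩ = (LinearMap.ker j).mkQ v :=
      j.quotKerEquivRange_symm_apply_image v _
    rw [LinearMap.comp_apply, LinearEquiv.coe_coe, hmk, Submodule.mkQ_apply,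
      Submodule.liftQ_apply]
  obtain ⟨L, hL, -⟩ := exists_extension_norm_eq (LinearMap.range j) (S.mkContinuous C (by
    rintro ⟨_, v, rfl⟩
    rw [hS]
    exact h v))
  exact ⟨L, fun v => ((hL ⟨j v, v, rfl⟩).trans (hS v)).symm⟩

theorem exists_eq_clm_jets (T : Distr d) (K : Compacts (E d)) :
    ∃ (N : ℕ) (L : (∀ k : Fin N, E d →ᵇ E d [×(k : ℕ)]→L[ℝ] ℂ) →L[ℂ] ℂ), ∀ φ : Test d,
      Function.support φ ⊆ K → T φ = L (jets N φ) := by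
  let T_K : 𝓓_{K}(E d, ℂ) →L[ℂ] ℂ :=
    T ∘L TestFunction.ofSupportedInCLM (n := ⊤) (Ω := ⊤) ℂ fun _ _ => trivial
  obtain ⟨s, C, -, hC⟩ := Seminorm.bound_of_continuous
    (ContDiffMapSupportedIn.withSeminorms ℂ (E d) ℂ ⊤ K)
    ((normSeminorm ℂ ℂ).comp T_K.toLinearMap) (continuous_norm.comp T_K.continuous)
  obtain ⟨N, hN⟩ := s.exists_nat_subset_range
  let j : 𝓓_{K}(E d, ℂ) →ₗ[ℂ] ∀ k : Fin N, E d →ᵇ E d [×(k : ℕ)]→L[ℝ] ℂ :=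
    LinearMap.pi fun k => ContDiffMapSupportedIn.structureMapLM ℂ ⊤ k
  obtain ⟨L, hL⟩ := exists_clm_eq_of_norm_le j T_K.toLinearMap C fun φ =>
    (hC φ).trans (mul_le_mul_of_nonneg_left
      (Seminorm.finset_sup_apply_le (norm_nonneg _) fun k hk =>
        norm_le_pi_norm (j φ) ⟨k, Finset.mem_range.1 (hN hk)⟩) C.2)
  refine ⟨N, L, fun φ hφ => (hL (.of_support_subset φ.contDiff hφ)).trans (congrArg L ?_)⟩
  refine funext fun k => BoundedContinuousFunction.ext fun x => ?_
  exact congrFun (ContDiffMapSupportedIn.structureMapLM_top_apply ℂ _) x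

theorem iteratedFDeriv_comp_sub_left {V W : Type*} [NormedAddCommGroup V] [NormedSpace ℝ V]
    [NormedAddCommGroup W] [NormedSpace ℝ W] {g : V → W} {k : ℕ} (hg : ContDiff ℝ k g) (y x : V) :
    iteratedFDeriv ℝ k (fun x => g (y - x)) x = (-1 : ℝ) ^ k • iteratedFDeriv ℝ k g (y - x) := by
  have h := congrFun (iteratedFDeriv_comp_const_smul (𝕜 := ℝ) (i := k) (-1)
    (f := fun z => g (y + z)) (hg.comp (by fun_prop))) x
  simp only [iteratedFDeriv_comp_add_left] at h
  simpa only [neg_smul, one_smul, ← sub_eq_add_neg] using h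

theorem jets_reflect {N : ℕ} (θ : Test d) (y : E d) (k : Fin N) :
    jets N (reflect θ y) k = shift ((-1 : ℝ) ^ (k : ℕ) • jet (k : ℕ) θ) y :=
  BoundedContinuousFunction.ext fun x =>
    iteratedFDeriv_comp_sub_left (θ.contDiff.of_le (by exact_mod_cast le_top)) y x

theorem contDiff_jets_reflect (N : ℕ) (θ : Test d) :
    ContDiff ℝ ∞ fun y => jets N (reflect θ y) := by
  refine contDiff_pi.2 fun k => ?_
  simp only [jets_reflect]
  exact contDiff_shift _

theorem norm_iteratedFDeriv_jets_reflect_le {N n : ℕ} {θ : Test d} {M : ℝ}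
    (hθ : ∀ k ≤ N + n, ∀ x, ‖iteratedFDeriv ℝ k θ x‖ ≤ M) (y : E d) :
    ‖iteratedFDeriv ℝ n (fun y => jets N (reflect θ y)) y‖ ≤ M := by
  have hM : 0 ≤ M := (norm_nonneg _).trans (hθ 0 (Nat.zero_le _) 0)
  have hn : (n : WithTop ℕ∞) ≤ ∞ := by exact_mod_cast le_top
  refine norm_iteratedFDeriv_pi_le ((contDiff_jets_reflect N θ).of_le hn) hM fun k => ?_
  simp only [jets_reflect]
  refine norm_iteratedFDeriv_shift_le _ hM (fun x => ?_) y
  have hcoe : ⇑((-1 : ℝ) ^ (k : ℕ) • jet k θ) = (-1 : ℝ) ^ (k : ℕ) • ⇑(jet k θ) := rfl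
  rw [hcoe, iteratedFDeriv_const_smul_apply ((jet k θ).contDiff.of_le hn).contDiffAt, norm_smul,
    coe_jet, norm_iteratedFDeriv_iteratedFDeriv, norm_pow, norm_neg, norm_one, one_pow, one_mul]
  exact hθ _ (by omega) x

end Jets

section Convolution

variable {d : ℕ}

theorem exists_forall_eq_zero {W : Type*} [NormedAddCommGroup W] [NormedSpace ℝ W]
    (θ : 𝓓((⊤ : Opens (E d)), W)) : ∃ r, ∀ x, r ≤ ‖x‖ → θ x = 0 := by
  obtain ⟨r, hr⟩ := θ.hasCompactSupport.isCompact.isBounded.subset_ball 0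
  exact ⟨r, fun x hx => image_eq_zero_of_notMem_tsupport fun h =>
    (mem_ball_zero_iff.1 (hr h)).not_ge hx⟩

/-- The closed ball of radius `R` around the origin, as a compact set. -/
def compactBall (d : ℕ) (R : ℝ) : Compacts (E d) :=
  ⟨Metric.closedBall 0 R, isCompact_closedBall 0 R⟩

theorem support_reflect_subset {θ : Test d} {r R : ℝ} (hθ : ∀ x, r ≤ ‖x‖ → θ x = 0) {y : E d}
    (hy : ‖y‖ ≤ R) : Function.support (reflect θ y) ⊆ compactBall d (R + r) := by
  refine Function.support_subset_iff'.2 fun x hx => hθ (y - x) ?_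
  have hxR : R + r < ‖x‖ := not_le.1 fun h => hx (mem_closedBall_zero_iff.2 h)
  linarith [norm_sub_norm_le x y, norm_sub_rev x y]

theorem exists_conv_eq_clm_jets (T : Distr d) (R r : ℝ) :
    ∃ (N : ℕ) (L : (∀ k : Fin N, E d →ᵇ E d [×(k : ℕ)]→L[ℝ] ℂ) →L[ℂ] ℂ), ∀ θ : Test d,
      (∀ x, r ≤ ‖x‖ → θ x = 0) → ∀ y, ‖y‖ < R →
        conv T θ =ᶠ[𝓝 y] L.restrictScalars ℝ ∘ fun y => jets N (reflect θ y) := by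
  obtain ⟨N, L, hL⟩ := exists_eq_clm_jets T (compactBall d (R + r))
  refine ⟨N, L, fun θ hθ y hy => ?_⟩
  filter_upwards [continuous_norm.continuousAt.eventually_lt continuousAt_const hy] with z hz
  exact hL _ (support_reflect_subset hθ hz.le)

theorem contDiff_conv (T : Distr d) (θ : Test d) : ContDiff ℝ ∞ (conv T θ) := by
  refine contDiff_iff_contDiffAt.2 fun y => ?_
  obtain ⟨r, hr⟩ := exists_forall_eq_zero θ
  obtain ⟨N, L, hL⟩ := exists_conv_eq_clm_jets T (‖y‖ + 1) r
  exact ((L.restrictScalars ℝ).contDiff.comp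
    (contDiff_jets_reflect N θ)).contDiffAt.congr_of_eventuallyEq (hL θ hr y (lt_add_one _))

theorem exists_norm_iteratedFDeriv_conv_le (T : Distr d) (R r : ℝ) :
    ∃ (N : ℕ) (C : ℝ), 0 ≤ C ∧ ∀ θ : Test d, (∀ x, r ≤ ‖x‖ → θ x = 0) → ∀ (n : ℕ) (M : ℝ),
      (∀ k ≤ N + n, ∀ x, ‖iteratedFDeriv ℝ k θ x‖ ≤ M) →
        ∀ y, ‖y‖ < R → ‖iteratedFDeriv ℝ n (conv T θ) y‖ ≤ C * M := by
  obtain ⟨N, L, hL⟩ := exists_conv_eq_clm_jets T R r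
  refine ⟨N, ‖L.restrictScalars ℝ‖, norm_nonneg _, fun θ hθ n M hM y hy => ?_⟩
  rw [((hL θ hθ y hy).iteratedFDeriv ℝ n).eq_of_nhds]
  exact ((L.restrictScalars ℝ).norm_iteratedFDeriv_comp_left
    (contDiff_jets_reflect N θ).contDiffAt (by exact_mod_cast le_top)).trans
    (mul_le_mul_of_nonneg_left (norm_iteratedFDeriv_jets_reflect_le hM y) (norm_nonneg _))

end Convolution

section Integral

variable {V : Type*} [NormedAddCommGroup V] [MeasurableSpace V] [BorelSpace V] {μ : Measure V}
  [IsFiniteMeasureOnCompacts μ]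

theorem integrable_smul_sub {W : Type*} [NormedAddCommGroup W] [NormedSpace ℂ W] {w : V → ℂ}
    (hw : Continuous w) (hc : HasCompactSupport w) {G : V → W} (hG : Continuous G) (y : V) :
    Integrable (fun x => w x • G (y - x)) μ :=
  (hw.smul (hG.comp (by fun_prop))).integrable_of_hasCompactSupport hc.smul_right

variable [NormedSpace ℝ V] [FiniteDimensional ℝ V] {W : Type*} [NormedAddCommGroup W]
  [NormedSpace ℝ W] [NormedSpace ℂ W] [SMulCommClass ℝ ℂ W]

theorem hasFDerivAt_integral_smul_sub {w : V → ℂ} (hw : Continuous w) (hc : HasCompactSupport w)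
    {G : V → W} (hG : ContDiff ℝ 1 G) (y : V) :
    HasFDerivAt (fun y => ∫ x, w x • G (y - x) ∂μ) (∫ x, w x • fderiv ℝ G (y - x) ∂μ) y := by
  have hG' : Continuous (fderiv ℝ G) := hG.continuous_fderiv one_ne_zero
  obtain ⟨M, hM⟩ : ∃ M, ∀ z ∈ Metric.ball y 1, ∀ x ∈ tsupport w, ‖fderiv ℝ G (z - x)‖ ≤ M := by
    have : ProperSpace V := FiniteDimensional.proper ℝ V
    obtain ⟨M, hM⟩ := ((isCompact_closedBall y 1).prod hc.isCompact).exists_bound_of_continuousOn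
      (f := fun p => fderiv ℝ G (p.1 - p.2)) (by fun_prop)
    exact ⟨M, fun z hz x hx => hM (z, x) ⟨Metric.ball_subset_closedBall hz, hx⟩⟩
  refine hasFDerivAt_integral_of_dominated_of_fderiv_le (𝕜 := ℝ) (bound := fun x => ‖w x‖ * M)
    (F := fun y x => w x • G (y - x)) (F' := fun y x => w x • fderiv ℝ G (y - x))
    (Metric.ball_mem_nhds y one_pos)
    (Eventually.of_forall fun z =>
      (integrable_smul_sub hw hc hG.continuous z).aestronglyMeasurable)
    (integrable_smul_sub hw hc hG.continuous y)
    (integrable_smul_sub hw hc hG' y).aestronglyMeasurable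
    (Eventually.of_forall fun x z hz => ?_)
    ((hw.norm.integrable_of_hasCompactSupport hc.norm).mul_const M)
    (Eventually.of_forall fun x z _ => ?_)
  · rw [norm_smul]
    by_cases hx : x ∈ tsupport w
    · exact mul_le_mul_of_nonneg_left (hM z hz x hx) (norm_nonneg _)
    · simp only [image_eq_zero_of_notMem_tsupport hx, norm_zero, zero_mul, le_refl]
  · exact (((hG.differentiable one_ne_zero).differentiableAt.hasFDerivAt.comp z
      ((hasFDerivAt_id z).sub_const x)).const_smul (w x))

theorem iteratedFDeriv_integral_smul_sub {w : V → ℂ} (hw : Continuous w)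
    (hc : HasCompactSupport w) {G : V → W} {k : ℕ} (hG : ContDiff ℝ k G) :
    iteratedFDeriv ℝ k (fun y => ∫ x, w x • G (y - x) ∂μ) =
      fun y => ∫ x, w x • iteratedFDeriv ℝ k G (y - x) ∂μ := by
  induction k with
  | zero =>
    let I : W ≃ₗᵢ[ℝ] (V [×0]→L[ℝ] W) := (continuousMultilinearCurryFin0 ℝ V W).symm
    exact funext fun y => (I.toContinuousLinearEquiv.integral_comp_comm
      (μ := μ) fun x => w x • G (y - x)).symm
  | succ k ih =>
    let I : (V →L[ℝ] V [×k]→L[ℝ] W) ≃ₗᵢ[ℝ] (V [×(k + 1)]→L[ℝ] W) :=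
      (continuousMultilinearCurryLeftEquiv ℝ (fun _ : Fin (k + 1) => V) W).symm
    have hI : ∀ f : V → W, iteratedFDeriv ℝ (k + 1) f = I ∘ fderiv ℝ (iteratedFDeriv ℝ k f) :=
      fun f => iteratedFDeriv_succ_eq_comp_left
    funext y
    rw [hI, ih (hG.of_le (by norm_cast; omega)), Function.comp_apply,
      (hasFDerivAt_integral_smul_sub hw hc (hG.iteratedFDeriv_right (by norm_cast; omega))
        y).fderiv, hI]
    exact (I.toContinuousLinearEquiv.integral_comp_comm (μ := μ)
      fun x => w x • fderiv ℝ (iteratedFDeriv ℝ k G) (y - x)).symm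

end Integral

section Taylor

variable {V W : Type*} [NormedAddCommGroup V] [NormedSpace ℝ V] [NormedAddCommGroup W]
  [NormedSpace ℝ W]

/-- The Taylor polynomial of degree `n` of `G` at `y`, as a function of the increment. -/
def taylorPoly (G : V → W) (y : V) (n : ℕ) (x : V) : W :=
  ∑ k ∈ Finset.range (n + 1), (k.factorial : ℝ)⁻¹ • iteratedFDeriv ℝ k G y fun _ => x

theorem norm_inv_factorial_le_one (k : ℕ) : ‖(k.factorial : ℝ)⁻¹‖ ≤ 1 := by
  rw [norm_inv, Real.norm_natCast]
  exact inv_le_one_of_one_le₀ (by exact_mod_cast k.factorial_pos)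

theorem norm_apply_diag_le {n : ℕ} {A : V [×n]→L[ℝ] W} {M : ℝ} (hA : ‖A‖ ≤ M) (x : V) :
    ‖A fun _ => x‖ ≤ M * ‖x‖ ^ n := by
  simpa using A.le_of_opNorm_le hA fun _ => x

theorem norm_taylorPoly_le {G : V → W} {y : V} {n : ℕ} {M : ℝ}
    (h : ∀ k ≤ n, ‖iteratedFDeriv ℝ k G y‖ ≤ M) (x : V) :
    ‖taylorPoly G y n x‖ ≤ (n + 1) * M * (1 + ‖x‖) ^ n := by
  have hM : 0 ≤ M := (norm_nonneg _).trans (h 0 n.zero_le)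
  have hterm : ∀ k ∈ Finset.range (n + 1),
      ‖(k.factorial : ℝ)⁻¹ • iteratedFDeriv ℝ k G y fun _ => x‖ ≤ M * (1 + ‖x‖) ^ n := by
    intro k hk
    have hk : k ≤ n := Nat.le_of_lt_succ (Finset.mem_range.1 hk)
    calc ‖(k.factorial : ℝ)⁻¹ • iteratedFDeriv ℝ k G y fun _ => x‖
        ≤ ‖iteratedFDeriv ℝ k G y fun _ => x‖ :=
          (norm_smul_le _ _).trans
            (mul_le_of_le_one_left (norm_nonneg _) (norm_inv_factorial_le_one k))
      _ ≤ M * ‖x‖ ^ k := norm_apply_diag_le (h k hk) x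
      _ ≤ M * (1 + ‖x‖) ^ k := by gcongr; linarith
      _ ≤ M * (1 + ‖x‖) ^ n := by gcongr; linarith [norm_nonneg x]
  refine (norm_sum_le_of_le _ hterm).trans (le_of_eq ?_)
  rw [Finset.sum_const, Finset.card_range, nsmul_eq_mul, Nat.cast_succ, mul_assoc]

theorem norm_add_sub_taylorPoly_le [CompleteSpace W] {G : V → W} {n : ℕ}
    (hG : ContDiff ℝ (n + 1) G) {y : V} {M R : ℝ}
    (h : ∀ x, ‖x‖ ≤ R → ‖iteratedFDeriv ℝ (n + 1) G (y + x)‖ ≤ M) {x : V} (hx : ‖x‖ ≤ R) :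
    ‖G (y + x) - taylorPoly G y n x‖ ≤ M * ‖x‖ ^ (n + 1) := by
  have hrem : ∀ t ∈ Set.uIoc (0 : ℝ) 1,
      ‖(1 - t) ^ n • iteratedFDeriv ℝ (n + 1) G (y + t • x) fun _ => x‖ ≤
        M * ‖x‖ ^ (n + 1) := by
    intro t ht
    rw [uIoc_of_le zero_le_one] at ht
    have hweight : ‖(1 - t) ^ n‖ ≤ 1 := by
      rw [norm_pow, Real.norm_of_nonneg (sub_nonneg.2 ht.2)]
      exact pow_le_one₀ (sub_nonneg.2 ht.2) (sub_le_self 1 ht.1.le)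
    have htx : ‖t • x‖ ≤ R := by
      rw [norm_smul, Real.norm_of_nonneg ht.1.le]
      exact (mul_le_of_le_one_left (norm_nonneg _) ht.2).trans hx
    exact (norm_smul_le _ _).trans ((mul_le_of_le_one_left (norm_nonneg _) hweight).trans
      (norm_apply_diag_le (h _ htx) x))
  have hint := intervalIntegral.norm_integral_le_of_norm_le_const hrem
  rw [sub_zero, abs_one, mul_one] at hint
  rw [map_add_eq_sum_add_integral_iteratedFDeriv fun t _ => hG.contDiffAt, taylorPoly,
    add_sub_cancel_left, norm_smul]
  exact (mul_le_of_le_one_left (norm_nonneg _) (norm_inv_factorial_le_one n)).trans hint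

theorem smul_taylorPoly_smul [NormedSpace ℂ W] [SMulCommClass ℝ ℂ W] (a : ℂ) (G : V → W) (y : V)
    (n : ℕ) (c : ℝ) (z : V) :
    a • taylorPoly G y n (c • z) = ∑ k ∈ Finset.range (n + 1),
      ((k.factorial : ℝ)⁻¹ * c ^ k) • a • iteratedFDeriv ℝ k G y fun _ => z := by
  refine Finset.smul_sum.trans (Finset.sum_congr rfl fun k _ => ?_)
  have h := (iteratedFDeriv ℝ k G y).map_smul_univ (fun _ => c) fun _ => z
  rw [Finset.prod_const, Finset.card_univ, Fintype.card_fin] at h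
  rw [h, mul_smul, smul_comm a, smul_comm a]

/-- The cut-off error is only felt where `1 ≤ t`, which lets it absorb any power of `t`. -/
theorem norm_smul_add_sub_taylorPoly_le [CompleteSpace W] {G : V → W} {n : ℕ}
    (hG : ContDiff ℝ (n + 1) G) {y : V} {M R : ℝ} (hR : 0 ≤ R)
    (h : ∀ k ≤ n + 1, ∀ x, ‖x‖ ≤ R → ‖iteratedFDeriv ℝ k G (y + x)‖ ≤ M) {c B t : ℝ} {x : V}
    (hcB : |c| ≤ B) (hc_zero : R < ‖x‖ → c = 0) (ht : 0 ≤ t) (hc_one : t < 1 → c = 1) (m : ℕ) :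
    ‖c • G (y + x) - taylorPoly G y n x‖ ≤
      B * (M * ‖x‖ ^ (n + 1)) + (B + 1) * ((n + 1) * M * (1 + ‖x‖) ^ n) * t ^ m := by
  have hM : 0 ≤ M := (norm_nonneg _).trans (h 0 (Nat.zero_le _) 0 (by rwa [norm_zero]))
  have hB : 0 ≤ B := (abs_nonneg c).trans hcB
  have hremainder : ‖c • (G (y + x) - taylorPoly G y n x)‖ ≤ B * (M * ‖x‖ ^ (n + 1)) := by
    rcases le_or_gt ‖x‖ R with hx | hx
    · refine (norm_smul_le _ _).trans (mul_le_mul hcB ?_ (norm_nonneg _) hB)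
      exact norm_add_sub_taylorPoly_le hG (h (n + 1) le_rfl) hx
    · rw [hc_zero hx, zero_smul, norm_zero]
      positivity
  have hcutoff : ‖(c - 1) • taylorPoly G y n x‖ ≤
      (B + 1) * ((n + 1) * M * (1 + ‖x‖) ^ n) * t ^ m := by
    rcases lt_or_ge t 1 with ht1 | ht1
    · rw [hc_one ht1, sub_self, zero_smul, norm_zero]
      positivity
    · refine le_trans ?_ (le_mul_of_one_le_right (by positivity) (one_le_pow₀ ht1))
      refine (norm_smul_le _ _).trans (mul_le_mul ?_ ?_ (norm_nonneg _) (by positivity))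
      · exact (norm_sub_le c 1).trans (by simpa using hcB)
      · refine norm_taylorPoly_le (fun k hk => ?_) x
        simpa using h k (by omega) 0 (by rwa [norm_zero])
  have hsplit : c • G (y + x) - taylorPoly G y n x =
      c • (G (y + x) - taylorPoly G y n x) + (c - 1) • taylorPoly G y n x := by
    rw [smul_sub, sub_smul, one_smul]
    abel
  rw [hsplit]
  exact norm_add_le_of_le hremainder hcutoff

end Taylor

section Moments

/-- `ρ` has the moments of the Dirac measure at the origin: total mass one, while all moments of
positive order vanish. -/
structure HasDiracMoments {d : ℕ} (ρ : E d → ℂ) : Prop where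
  integral_eq_one : ∫ x, ρ x = 1
  moment_eq_zero : ∀ m : Fin d → ℕ, m ≠ 0 → ∫ x, ((∏ i, x i ^ m i : ℝ) : ℂ) * ρ x = 0

variable {d : ℕ} {W : Type*} [NormedAddCommGroup W] [NormedSpace ℝ W]

theorem apply_diag_eq_sum {n : ℕ} (A : E d [×n]→L[ℝ] W) (z : E d) :
    (A fun _ => z) = ∑ f : Fin n → Fin d,
      (∏ j, z (f j)) • A fun j => EuclideanSpace.single (f j) (1 : ℝ) := by
  have hz : z = ∑ i, z i • EuclideanSpace.single i (1 : ℝ) := by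
    simpa using ((EuclideanSpace.basisFun (Fin d) ℝ).sum_repr z).symm
  conv_lhs => rw [hz]
  rw [A.map_sum]
  exact Finset.sum_congr rfl fun f _ => A.map_smul_univ _ _

theorem integrable_prod_mul (ρ : 𝓢(E d, ℂ)) {n : ℕ} (f : Fin n → Fin d) :
    Integrable fun z => ((∏ j, z (f j) : ℝ) : ℂ) * ρ z := by
  refine (ρ.integrable_pow_mul volume n).mono' (Continuous.aestronglyMeasurable (by fun_prop))
    (Eventually.of_forall fun z => ?_)
  rw [norm_mul, Complex.norm_real, norm_prod]
  gcongr
  simpa using Finset.prod_le_prod (fun _ _ => norm_nonneg _)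
    (fun j (_ : j ∈ Finset.univ) => PiLp.norm_apply_le z (f j))

theorem HasDiracMoments.integral_prod_mul {ρ : E d → ℂ} (hρ : HasDiracMoments ρ) {n : ℕ}
    (hn : n ≠ 0) (f : Fin n → Fin d) : ∫ z, ((∏ j, z (f j) : ℝ) : ℂ) * ρ z = 0 := by
  let m : Fin d → ℕ := fun i => (Finset.univ.filter fun j => f j = i).card
  have hprod : ∀ z : E d, ∏ j, z (f j) = ∏ i, z i ^ m i := fun z => by
    rw [← Finset.prod_fiberwise' Finset.univ f (fun i => z i)]
    simp only [Finset.prod_const, m]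
  simp_rw [hprod]
  refine hρ.moment_eq_zero m fun hm => ?_
  have hcard := congrFun hm (f ⟨0, Nat.pos_of_ne_zero hn⟩)
  rw [Pi.zero_apply, Finset.card_eq_zero, Finset.filter_eq_empty_iff] at hcard
  exact hcard (Finset.mem_univ _) rfl

variable [NormedSpace ℂ W]

theorem integrable_smul_apply_diag (ρ : 𝓢(E d, ℂ)) {n : ℕ} (A : E d [×n]→L[ℝ] W) :
    Integrable fun z => ρ z • A fun _ => z := by
  refine ((ρ.integrable_pow_mul volume n).const_mul ‖A‖).mono'
    ((ρ.continuous.smul (A.cont.comp (by fun_prop))).aestronglyMeasurable)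
    (Eventually.of_forall fun z => ?_)
  rw [norm_smul, mul_comm, ← mul_assoc]
  exact mul_le_mul_of_nonneg_right (norm_apply_diag_le le_rfl z) (norm_nonneg _)

variable [IsScalarTower ℝ ℂ W] {ρ : 𝓢(E d, ℂ)}

theorem ofReal_smul (r : ℝ) (v : W) : (r : ℂ) • v = r • v := algebraMap_smul ℂ r v

theorem HasDiracMoments.integral_smul_apply_diag [CompleteSpace W] (hρ : HasDiracMoments ρ)
    {n : ℕ} (hn : n ≠ 0) (A : E d [×n]→L[ℝ] W) : ∫ z, ρ z • (A fun _ => z) = 0 := by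
  have hterm : ∀ (z : E d) (f : Fin n → Fin d) (v : W),
      ρ z • (∏ j, z (f j)) • v = (((∏ j, z (f j) : ℝ) : ℂ) * ρ z) • v := fun z f v => by
    rw [mul_comm, mul_smul, ofReal_smul]
  simp_rw [apply_diag_eq_sum A, Finset.smul_sum, hterm]
  rw [integral_finsetSum _ fun f _ => (integrable_prod_mul ρ f).smul_const _]
  refine Finset.sum_eq_zero fun f _ => ?_
  rw [integral_smul_const, hρ.integral_prod_mul hn, zero_smul]

theorem integrable_smul_taylorPoly (ρ : 𝓢(E d, ℂ)) (G : E d → W) (y : E d) (n : ℕ) (c : ℝ) :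
    Integrable fun z => ρ z • taylorPoly G y n (c • z) := by
  simp_rw [smul_taylorPoly_smul]
  exact integrable_finsetSum _ fun k _ => (integrable_smul_apply_diag ρ _).smul _

theorem HasDiracMoments.integral_smul_taylorPoly [CompleteSpace W] (hρ : HasDiracMoments ρ)
    (G : E d → W) (y : E d) (n : ℕ) (c : ℝ) : ∫ z, ρ z • taylorPoly G y n (c • z) = G y := by
  simp_rw [smul_taylorPoly_smul]
  rw [integral_finsetSum _ fun k _ =>
      (integrable_smul_apply_diag ρ (iteratedFDeriv ℝ k G y)).fun_smul
        ((k.factorial : ℝ)⁻¹ * c ^ k),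
    Finset.sum_range_succ', Finset.sum_eq_zero fun k _ => ?_]
  · simp [integral_smul_const, hρ.integral_eq_one]
  · rw [integral_smul, hρ.integral_smul_apply_diag k.succ_ne_zero, smul_zero]

theorem integrable_one_add_norm_pow_mul (ρ : 𝓢(E d, ℂ)) (n : ℕ) :
    Integrable fun z => (1 + ‖z‖) ^ n * ‖ρ z‖ := by
  simp_rw [add_pow, Finset.sum_mul]
  refine integrable_finsetSum _ fun k _ => ?_
  refine ((ρ.integrable_pow_mul volume (n - k)).const_mul (n.choose k : ℝ)).congr
    (Eventually.of_forall fun z => ?_)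
  simp only [one_pow]
  ring

theorem HasDiracMoments.norm_integral_smul_sub_le [CompleteSpace W] (hρ : HasDiracMoments ρ)
    {F G : E d → W} (hF : Continuous F) {y : E d} {n m : ℕ} {c C : ℝ}
    (h : ∀ z, ‖F z - taylorPoly G y n (c • z)‖ ≤ C * (1 + ‖z‖) ^ m) :
    ‖(∫ z, ρ z • F z) - G y‖ ≤ C * ∫ z, (1 + ‖z‖) ^ m * ‖ρ z‖ := by
  have hbound : ∀ z, ‖ρ z • F z - ρ z • taylorPoly G y n (c • z)‖ ≤
      C * ((1 + ‖z‖) ^ m * ‖ρ z‖) := fun z => by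
    rw [← smul_sub, norm_smul, mul_comm, ← mul_assoc]
    exact mul_le_mul_of_nonneg_right (h z) (norm_nonneg _)
  have hdom := (integrable_one_add_norm_pow_mul ρ m).const_mul C
  have hpoly := integrable_smul_taylorPoly ρ G y n c
  have hdiff := hdom.mono' ((ρ.continuous.smul hF).aestronglyMeasurable.sub
    hpoly.aestronglyMeasurable) (Eventually.of_forall hbound)
  have hint : Integrable fun z => ρ z • F z :=
    (hdiff.add hpoly).congr (Eventually.of_forall fun z => sub_add_cancel _ _)
  rw [← hρ.integral_smul_taylorPoly G y n c, ← integral_sub hint hpoly, ← integral_const_mul]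
  exact norm_integral_le_of_norm_le hdom (Eventually.of_forall hbound)

end Moments

section Scaling

variable {V : Type*} [NormedAddCommGroup V] [NormedSpace ℝ V]

theorem exists_forall_norm_iteratedFDeriv_le {W : Type*} [NormedAddCommGroup W] [NormedSpace ℝ W]
    (f : 𝓢(V, W)) (k : ℕ) : ∃ A, ∀ i ≤ k, ∀ x, ‖iteratedFDeriv ℝ i f x‖ ≤ A :=
  ⟨_, fun i hi x => by
    simpa only [pow_zero, one_mul] using
      SchwartzMap.one_add_le_sup_seminorm_apply (𝕜 := ℝ) (m := (0, k)) le_rfl hi f x⟩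

theorem norm_iteratedFDeriv_comp_smul_le {W : Type*} [NormedAddCommGroup W] [NormedSpace ℝ W]
    {f : V → W} {k : ℕ} (hf : ContDiff ℝ k f) {a c A : ℝ} (ha : |a| ≤ c)
    (hA : ∀ x, ‖iteratedFDeriv ℝ k f x‖ ≤ A) (x : V) :
    ‖iteratedFDeriv ℝ k (fun x => f (a • x)) x‖ ≤ c ^ k * A := by
  rw [iteratedFDeriv_comp_const_smul a hf, norm_smul, norm_pow, Real.norm_eq_abs]
  exact mul_le_mul (pow_le_pow_left₀ (abs_nonneg a) ha k) (hA _) (norm_nonneg _)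
    (pow_nonneg ((abs_nonneg a).trans ha) k)

theorem norm_iteratedFDeriv_mul_comp_smul_le {𝔸 : Type*} [NormedRing 𝔸] [NormedAlgebra ℝ 𝔸]
    {f g : V → 𝔸} {k : ℕ} (hf : ContDiff ℝ k f) (hg : ContDiff ℝ k g) {a b c A B : ℝ}
    (ha : |a| ≤ c) (hb : |b| ≤ c) (hA : ∀ i ≤ k, ∀ x, ‖iteratedFDeriv ℝ i f x‖ ≤ A)
    (hB : ∀ i ≤ k, ∀ x, ‖iteratedFDeriv ℝ i g x‖ ≤ B) (x : V) :
    ‖iteratedFDeriv ℝ k (fun x => f (a • x) * g (b • x)) x‖ ≤ 2 ^ k * (c ^ k * (A * B)) := by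
  have hc : 0 ≤ c := (abs_nonneg a).trans ha
  have hA0 : 0 ≤ A := (norm_nonneg _).trans (hA 0 k.zero_le 0)
  refine (norm_iteratedFDeriv_mul_le (hf.comp (contDiff_const_smul a))
    (hg.comp (contDiff_const_smul b)) x le_rfl).trans ?_
  have hterm : ∀ i ∈ Finset.range (k + 1),
      (k.choose i : ℝ) * ‖iteratedFDeriv ℝ i (fun x => f (a • x)) x‖ *
        ‖iteratedFDeriv ℝ (k - i) (fun x => g (b • x)) x‖ ≤ k.choose i * (c ^ k * (A * B)) := by
    intro i hi
    have hi : i ≤ k := Nat.le_of_lt_succ (Finset.mem_range.1 hi)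
    have hpow : c ^ k = c ^ i * c ^ (k - i) := by rw [← pow_add, Nat.add_sub_cancel' hi]
    rw [mul_assoc, hpow, mul_mul_mul_comm]
    gcongr
    · exact norm_iteratedFDeriv_comp_smul_le (hf.of_le (by exact_mod_cast hi)) ha (hA i hi) x
    · exact norm_iteratedFDeriv_comp_smul_le (hg.of_le (by exact_mod_cast k.sub_le i)) hb
        (hB _ (k.sub_le i)) x
  refine (Finset.sum_le_sum hterm).trans (le_of_eq ?_)
  rw [← Finset.sum_mul]
  exact_mod_cast congrArg (· * (c ^ k * (A * B))) (congrArg (Nat.cast (R := ℝ))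
    (Nat.sum_range_choose k))

theorem abs_log_le_inv {ε : ℝ} (h0 : 0 < ε) (h1 : ε ≤ 1) : |Real.log ε| ≤ ε⁻¹ := by
  have h := Real.abs_log_mul_self_lt ε h0 h1
  rw [abs_mul, abs_of_pos h0] at h
  rw [← one_div, le_div_iff₀ h0]
  exact h.le

theorem sq_abs_log_mul_self_le {ε : ℝ} (h0 : 0 < ε) (h1 : ε ≤ 1) :
    (|Real.log ε| * ε) ^ 2 ≤ 4 * ε := by
  have hsqrt := Real.abs_log_mul_self_lt (√ε) (Real.sqrt_pos.2 h0) (Real.sqrt_le_one.2 h1)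
  rw [← sq_lt_one_iff_abs_lt_one, Real.log_sqrt h0.le, mul_pow, Real.sq_sqrt h0.le] at hsqrt
  rw [mul_pow, sq_abs]
  nlinarith

theorem abs_log_mul_self_mul_div_pow_le {ε : ℝ} (h0 : 0 < ε) (h1 : ε ≤ 1) (r s : ℝ) (m : ℕ) :
    (|Real.log ε| * ε * s / r) ^ (2 * m) ≤ (4 / r ^ 2) ^ m * ε ^ m * s ^ (2 * m) := by
  rw [pow_mul, pow_mul s, ← mul_pow, ← mul_pow]
  refine pow_le_pow_left₀ (sq_nonneg _) ?_ m
  rw [div_pow, mul_pow _ s, div_mul_eq_mul_div, div_mul_eq_mul_div]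
  gcongr
  exact sq_abs_log_mul_self_le h0 h1

/-- Where the cut-off `χ` differs from `1`, `|log ε| * ε * ‖z‖` is bounded below, while
`(|log ε| * ε) ^ 2 ≤ 4 * ε`: so `1` is at most a multiple of `ε ^ (n + 1) * ‖z‖ ^ (2 * (n + 1))`
there. -/
theorem norm_cutoff_smul_sub_taylorPoly_le {W : Type*} [NormedAddCommGroup W] [NormedSpace ℝ W]
    [CompleteSpace W] {χ : V → ℝ} {r R B : ℝ} (hr : 0 < r) (hR : 0 ≤ R)
    (hχ_one : ∀ x, ‖x‖ < r → χ x = 1) (hχ_zero : ∀ x, R ≤ ‖x‖ → χ x = 0) (hB : ∀ x, |χ x| ≤ B)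
    {G : V → W} {n : ℕ} (hG : ContDiff ℝ (n + 1) G) {y : V} {M : ℝ}
    (hM : ∀ k ≤ n + 1, ∀ x, ‖x‖ ≤ R → ‖iteratedFDeriv ℝ k G (y + x)‖ ≤ M) {ε : ℝ} (h0 : 0 < ε)
    (h1 : ε ≤ 1) (hlog : 1 ≤ |Real.log ε|) (z : V) :
    ‖χ (|Real.log ε| • ε • z) • G (y + (-ε) • z) - taylorPoly G y n ((-ε) • z)‖ ≤
      (B + (B + 1) * (n + 1) * (4 / r ^ 2) ^ (n + 1)) * M * ε ^ (n + 1) *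
        (1 + ‖z‖) ^ (3 * (n + 1)) := by
  have hM0 : 0 ≤ M := (norm_nonneg _).trans (hM 0 (Nat.zero_le _) 0 (by rwa [norm_zero]))
  have hB0 : 0 ≤ B := (abs_nonneg _).trans (hB 0)
  have hx : ‖(-ε) • z‖ = ε * ‖z‖ := by rw [norm_smul, norm_neg, Real.norm_of_nonneg h0.le]
  have harg : ‖|Real.log ε| • ε • z‖ = |Real.log ε| * ε * ‖z‖ := by
    rw [norm_smul, norm_smul, Real.norm_of_nonneg h0.le, Real.norm_of_nonneg (abs_nonneg _),
      mul_assoc]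
  set t := |Real.log ε| * ε * ‖z‖ / r
  set S := 1 + ‖z‖
  have hz : ‖z‖ ≤ S := le_add_of_nonneg_left zero_le_one
  have hS : 1 ≤ S := le_add_of_nonneg_right (norm_nonneg z)
  have hεz : 1 + ε * ‖z‖ ≤ S := by
    simpa only [add_le_add_iff_left, S] using mul_le_of_le_one_left (norm_nonneg z) h1
  have ht : t ^ (2 * (n + 1)) ≤ (4 / r ^ 2) ^ (n + 1) * ε ^ (n + 1) * S ^ (2 * (n + 1)) :=
    (abs_log_mul_self_mul_div_pow_le h0 h1 r ‖z‖ (n + 1)).trans (by gcongr)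
  have hexpansion := norm_smul_add_sub_taylorPoly_le hG hR hM (hB (|Real.log ε| • ε • z))
    (x := (-ε) • z) (t := t) (fun h => hχ_zero _ (by rw [hx] at h; rw [harg]; nlinarith))
    (by positivity) (fun h => hχ_one _ (by rwa [harg, ← div_lt_one hr])) (2 * (n + 1))
  rw [hx] at hexpansion
  clear_value S
  calc _ ≤ B * (M * (ε * ‖z‖) ^ (n + 1)) +
        (B + 1) * ((n + 1) * M * (1 + ε * ‖z‖) ^ n) * t ^ (2 * (n + 1)) := hexpansion
    _ ≤ B * (M * (ε * S) ^ (n + 1)) + (B + 1) * ((n + 1) * M * S ^ n) *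
        ((4 / r ^ 2) ^ (n + 1) * ε ^ (n + 1) * S ^ (2 * (n + 1))) := by gcongr
    _ = B * M * ε ^ (n + 1) * S ^ (n + 1) + (B + 1) * (n + 1) * (4 / r ^ 2) ^ (n + 1) *
        M * ε ^ (n + 1) * S ^ (3 * n + 2) := by ring
    _ ≤ B * M * ε ^ (n + 1) * S ^ (3 * (n + 1)) + (B + 1) * (n + 1) * (4 / r ^ 2) ^ (n + 1) *
        M * ε ^ (n + 1) * S ^ (3 * (n + 1)) := by gcongr <;> first | exact hS | omega
    _ = (B + (B + 1) * (n + 1) * (4 / r ^ 2) ^ (n + 1)) * M * ε ^ (n + 1) *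
        S ^ (3 * (n + 1)) := by ring

end Scaling

section Theta

variable {d : ℕ} {ρ : 𝓢(E d, ℂ)} {χ : 𝓓((⊤ : Opens (E d)), ℝ)}

theorem theta_apply (ε : Set.Ioo (0 : ℝ) 1) (x : E d) : theta ρ χ ε x =
    (((ε : ℝ) ^ d)⁻¹ : ℝ) * ρ ((ε : ℝ)⁻¹ • x) * (χ (|Real.log ε| • x) : ℂ) := rfl

variable (χ) in
theorem exists_theta_eq_zero : ∃ R, 0 ≤ R ∧ ∀ (ρ : 𝓢(E d, ℂ)) (ε : Set.Ioo (0 : ℝ) 1),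
    1 ≤ |Real.log ε| → ∀ x, R ≤ ‖x‖ → theta ρ χ ε x = 0 := by
  obtain ⟨R, hR⟩ := exists_forall_eq_zero χ
  refine ⟨max R 0, le_max_right _ _, fun ρ ε hε x hx => ?_⟩
  rw [theta_apply, hR, Complex.ofReal_zero, mul_zero]
  rw [norm_smul, Real.norm_eq_abs, abs_abs]
  exact (le_of_max_le_left hx).trans (le_mul_of_one_le_left (norm_nonneg x) hε)

variable (ρ χ) in
theorem exists_norm_iteratedFDeriv_theta_le (m : ℕ) :
    ∃ C : ℝ, 0 ≤ C ∧ ∀ (ε : Set.Ioo (0 : ℝ) 1), ∀ k ≤ m, ∀ x,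
      ‖iteratedFDeriv ℝ k (theta ρ χ ε) x‖ ≤ C * ((ε : ℝ) ^ (d + m))⁻¹ := by
  have hχc : ContDiff ℝ ∞ fun x : E d => (χ x : ℂ) := Complex.ofRealCLM.contDiff.comp χ.contDiff
  have hχs : HasCompactSupport fun x : E d => (χ x : ℂ) :=
    χ.hasCompactSupport.comp_left (g := Complex.ofReal) Complex.ofReal_zero
  obtain ⟨A, hA⟩ := exists_forall_norm_iteratedFDeriv_le ρ m
  obtain ⟨B, hB⟩ := exists_forall_norm_iteratedFDeriv_le (hχs.toSchwartzMap hχc) m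
  have hA0 : 0 ≤ A := (norm_nonneg _).trans (hA 0 m.zero_le 0)
  have hB0 : 0 ≤ B := (norm_nonneg _).trans (hB 0 m.zero_le 0)
  refine ⟨2 ^ m * (A * B), by positivity, fun ε k hk x => ?_⟩
  have hε := ε.2.1
  have hk' : (k : WithTop ℕ∞) ≤ ∞ := by exact_mod_cast le_top
  have hρk : ContDiff ℝ k ρ := (ρ.smooth ⊤).of_le hk'
  have hprod := norm_iteratedFDeriv_mul_comp_smul_le hρk (hχc.of_le hk')
    (abs_of_pos (inv_pos.2 hε)).le ((abs_abs _).trans_le (abs_log_le_inv hε ε.2.2.le))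
    (fun i hi => hA i (hi.trans hk)) (fun i hi => hB i (hi.trans hk)) x
  have hθ : ⇑(theta ρ χ ε) = ((ε : ℝ) ^ d)⁻¹ •
      fun x : E d => ρ ((ε : ℝ)⁻¹ • x) * (χ (|Real.log ε| • x) : ℂ) := by
    funext x
    rw [theta_apply, Pi.smul_apply, Complex.real_smul, mul_assoc]
  have hdiff : ContDiff ℝ k fun x : E d =>
      ρ ((ε : ℝ)⁻¹ • x) * (χ (|Real.log ε| • x) : ℂ) :=
    (hρk.comp (contDiff_const_smul _)).mul ((hχc.of_le hk').comp (contDiff_const_smul _))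
  rw [hθ, iteratedFDeriv_const_smul_apply hdiff.contDiffAt, norm_smul,
    Real.norm_of_nonneg (by positivity)]
  calc ((ε : ℝ) ^ d)⁻¹ * _ ≤ ((ε : ℝ) ^ d)⁻¹ * (2 ^ k * ((ε : ℝ)⁻¹ ^ k * (A * B))) := by gcongr
    _ ≤ ((ε : ℝ) ^ d)⁻¹ * (2 ^ m * ((ε : ℝ)⁻¹ ^ m * (A * B))) := by
      have := one_le_inv_iff₀.2 ⟨hε, ε.2.2.le⟩
      gcongr
      exact one_le_two
    _ = _ := by rw [pow_add, mul_inv, inv_pow]; ring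

variable {W : Type*} [NormedAddCommGroup W] [NormedSpace ℝ W] [NormedSpace ℂ W]
  [IsScalarTower ℝ ℂ W]

theorem integral_theta_smul (ε : Set.Ioo (0 : ℝ) 1) (G : E d → W) (y : E d) :
    ∫ x, theta ρ χ ε x • G (y - x) =
      ∫ z, ρ z • χ (|Real.log ε| • (ε : ℝ) • z) • G (y + (-(ε : ℝ)) • z) := by
  have hε := ε.2.1
  have hscale := Measure.integral_comp_smul volume
    (fun x : E d => ρ ((ε : ℝ)⁻¹ • x) • χ (|Real.log ε| • x) • G (y - x)) (ε : ℝ)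
  simp only [inv_smul_smul₀ hε.ne', finrank_euclideanSpace_fin] at hscale
  simp_rw [neg_smul, ← sub_eq_add_neg]
  rw [hscale, abs_of_pos (by positivity), ← integral_smul]
  exact integral_congr_ae (Eventually.of_forall fun x => by
    simp only [theta_apply, mul_smul, ofReal_smul])

end Theta

theorem HasDiracMoments.exists_norm_integral_theta_smul_sub_le {d : ℕ} {ρ : 𝓢(E d, ℂ)}
    (hρ : HasDiracMoments ρ) {χ : 𝓓((⊤ : Opens (E d)), ℝ)} (hχ : ∀ᶠ x in 𝓝 0, χ x = 1) (n : ℕ) :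
    ∃ R C : ℝ, 0 ≤ C ∧ ∀ {W : Type u} [NormedAddCommGroup W] [NormedSpace ℝ W] [NormedSpace ℂ W]
      [IsScalarTower ℝ ℂ W] [CompleteSpace W] {G : E d → W}, ContDiff ℝ (n + 1) G →
      ∀ {y : E d} {M : ℝ},
        (∀ k ≤ n + 1, ∀ x, ‖x‖ ≤ R → ‖iteratedFDeriv ℝ k G (y + x)‖ ≤ M) →
        ∀ {ε : Set.Ioo (0 : ℝ) 1}, 1 ≤ |Real.log ε| →
          ‖(∫ x, theta ρ χ ε x • G (y - x)) - G y‖ ≤ C * M * (ε : ℝ) ^ (n + 1) := by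
  obtain ⟨r, hr, hχ_one⟩ := Metric.eventually_nhds_iff_ball.1 hχ
  obtain ⟨R, hχ_zero⟩ := exists_forall_eq_zero χ
  obtain ⟨B, hB⟩ := χ.continuous.bounded_above_of_compact_support χ.hasCompactSupport
  have hB0 : 0 ≤ B := (norm_nonneg _).trans (hB 0)
  set K := B + (B + 1) * (n + 1) * (4 / r ^ 2) ^ (n + 1)
  set I := ∫ z, (1 + ‖z‖) ^ (3 * (n + 1)) * ‖ρ z‖
  have : 0 ≤ I := integral_nonneg fun z => by positivity
  refine ⟨max R 0, K * I, by positivity, ?_⟩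
  intro W _ _ _ _ _ G hG y M hM ε hlog
  have hcont : Continuous fun z : E d =>
      χ (|Real.log ε| • (ε : ℝ) • z) • G (y + (-(ε : ℝ)) • z) :=
    (χ.continuous.comp (by fun_prop)).smul (hG.continuous.comp (by fun_prop))
  rw [integral_theta_smul]
  refine (hρ.norm_integral_smul_sub_le hcont (C := K * M * (ε : ℝ) ^ (n + 1))
    (norm_cutoff_smul_sub_taylorPoly_le hr (le_max_right R 0)
      (fun x hx => hχ_one x (mem_ball_zero_iff.2 hx))
      (fun x hx => hχ_zero x (le_of_max_le_left hx)) hB hG hM ε.2.1 ε.2.2.le hlog)).trans_eq ?_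
  ring

section Asymptotics

variable {d : ℕ}

theorem tendsto_toZero : Tendsto (fun ε : I01 => (ε : ℝ)) toZero (𝓝 0) := tendsto_comap

instance : NeBot toZero := by
  refine comap_neBot_iff.2 fun s hs => ?_
  obtain ⟨r, hr, hs⟩ := Metric.mem_nhds_iff.1 hs
  refine ⟨⟨min (r / 2) 1, by positivity, min_le_right _ _⟩, hs ?_⟩
  rw [mem_ball_zero_iff, Real.norm_of_nonneg (by positivity)]
  exact (min_le_left _ _).trans_lt (half_lt_self hr)

theorem eventually_lt_one_and_one_le_abs_log :
    ∀ᶠ ε : I01 in toZero, (ε : ℝ) < 1 ∧ 1 ≤ |Real.log ε| := by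
  filter_upwards [tendsto_toZero.eventually (eventually_le_nhds (Real.exp_pos (-1)))] with ε hε
  have hlog : Real.log ε ≤ -1 := (Real.log_le_iff_le_exp ε.2.1).2 hε
  exact ⟨hε.trans_lt (Real.exp_lt_one_iff.mpr neg_one_lt_zero), le_abs.2 (.inr (le_neg.2 hlog))⟩

theorem pow_isLittleO_pow {m n : ℕ} (h : m < n) :
    (fun ε : I01 => (ε : ℝ) ^ n) =o[toZero] fun ε : I01 => (ε : ℝ) ^ m :=
  (Asymptotics.isLittleO_pow_pow h).comp_tendsto tendsto_toZero

theorem inv_pow_isLittleO_inv_pow {m n : ℕ} (h : m < n) :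
    (fun ε : I01 => ((ε : ℝ) ^ m)⁻¹) =o[toZero] fun ε : I01 => ((ε : ℝ) ^ n)⁻¹ :=
  (pow_isLittleO_pow h).inv_rev
    (Eventually.of_forall fun ε h0 => absurd h0 (pow_ne_zero n ε.2.1.ne'))

theorem pSemi_isLittleO_of_eventually_le {u : Net d} {K : Compacts (E d)} {l : ℕ} {g h : I01 → ℝ}
    (hu : ∀ᶠ ε in toZero, pSemi K l (u ε) ≤ g ε) (hgh : g =o[toZero] h) :
    (fun ε => pSemi K l (u ε)) =o[toZero] h := by
  refine Asymptotics.IsBigO.trans_isLittleO (Asymptotics.IsBigO.of_bound' ?_) hgh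
  filter_upwards [hu] with ε hε
  rw [Real.norm_of_nonneg (pSemi_nonneg K l _)]
  exact hε.trans (le_abs_self _)

theorem IsModerate.congr {u v : Net d} (hv : IsModerate v) (hu : ∀ ε, ContDiff ℝ ∞ (u ε))
    (huv : u =ᶠ[toZero] v) : IsModerate u :=
  ⟨hu, fun l K => (hv.2 l K).imp fun _ hq =>
    hq.congr' (huv.symm.fun_comp (pSemi K l)) EventuallyEq.rfl⟩

theorem IsNegligible.congr {u v : Net d} (hv : IsNegligible v) (hu : ∀ ε, ContDiff ℝ ∞ (u ε))
    (huv : u =ᶠ[toZero] v) : IsNegligible u :=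
  ⟨hu, fun l K p => (hv.2 l K p).congr' (huv.symm.fun_comp (pSemi K l)) EventuallyEq.rfl⟩

theorem mk_eq_mk_iff {u v : Net d} (hu : u ∈ Moderate d) (hv : v ∈ Moderate d) :
    G.mk u hu = G.mk v hv ↔ IsNegligible (u - v) :=
  Ideal.Quotient.mk_eq_mk_iff_sub_mem _ _

theorem mk_eq_mk_of_eventuallyEq {u v : Net d} (hu : u ∈ Moderate d) (hv : v ∈ Moderate d)
    (huv : u =ᶠ[toZero] v) : G.mk u hu = G.mk v hv :=
  (mk_eq_mk_iff hu hv).2 (isNegligible_zero.congr (fun ε => (hu.1 ε).sub (hv.1 ε))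
    (huv.mono fun _ h => sub_eq_zero.2 h))

theorem IsNegligible.tendsto_integral_smul {u : Net d} (hu : IsNegligible u) (φ : Test d) :
    Tendsto (fun ε => ∫ y, φ y • u ε y) toZero (𝓝 0) := by
  let K : Compacts (E d) := ⟨tsupport φ, φ.hasCompactSupport⟩
  have hφ : Integrable φ := φ.continuous.integrable_of_hasCompactSupport φ.hasCompactSupport
  have hK : Tendsto (fun ε => pSemi K 0 (u ε)) toZero (𝓝 0) := by
    simpa only [pow_zero, Asymptotics.isLittleO_one_iff] using hu.2 0 K 0
  have hbound : ∀ ε, ‖∫ y, φ y • u ε y‖ ≤ (∫ y, ‖φ y‖) * pSemi K 0 (u ε) := fun ε => by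
    rw [← integral_mul_const]
    refine norm_integral_le_of_norm_le (hφ.norm.mul_const _) (Eventually.of_forall fun y => ?_)
    rw [norm_smul]
    by_cases hy : y ∈ tsupport φ
    · have h := le_pSemi K 0 (hu.1 ε) le_rfl hy
      rw [norm_iteratedFDeriv_zero] at h
      exact mul_le_mul_of_nonneg_left h (norm_nonneg _)
    · simp only [image_eq_zero_of_notMem_tsupport hy, norm_zero, zero_mul, le_refl]
  exact squeeze_zero_norm hbound (by simpa only [mul_zero] using hK.const_mul (∫ y, ‖φ y‖))

end Asymptotics

section Regularization

variable {d : ℕ} {ρ : 𝓢(E d, ℂ)} {χ : 𝓓((⊤ : Opens (E d)), ℝ)} {T : Distr d}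

/-- `u` is the net of regularizations `T ∗ θ_ε`, with an arbitrary value at `ε = 1`. -/
def IsRegularization (ρ : 𝓢(E d, ℂ)) (χ : 𝓓((⊤ : Opens (E d)), ℝ)) (T : Distr d) (u : Net d) :
    Prop :=
  ∀ (ε : ℝ) (h0 : 0 < ε) (h1 : ε < 1), u ⟨ε, h0, h1.le⟩ = conv T (theta ρ χ ⟨ε, h0, h1⟩)

/-- The net of regularizations `T ∗ θ_ε`, completed by `0` at `ε = 1`: the representative used to
define `embedding`. -/
def regNet (ρ : 𝓢(E d, ℂ)) (χ : 𝓓((⊤ : Opens (E d)), ℝ)) (T : Distr d) : Net d := fun ε =>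
  if h : (ε : ℝ) < 1 then conv T (theta ρ χ ⟨ε, ε.2.1, h⟩) else 0

theorem regNet_of_lt_one {ε : I01} (h : (ε : ℝ) < 1) :
    regNet ρ χ T ε = conv T (theta ρ χ ⟨ε, ε.2.1, h⟩) := dif_pos h

theorem contDiff_regNet (ε : I01) : ContDiff ℝ ∞ (regNet ρ χ T ε) := by
  unfold regNet
  split_ifs
  · exact contDiff_conv T _
  · exact contDiff_const

theorem regNet_add (S T : Distr d) : regNet ρ χ (S + T) = regNet ρ χ S + regNet ρ χ T := by
  funext ε
  simp only [regNet, Pi.add_apply]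
  split_ifs
  · rfl
  · exact (add_zero _).symm

theorem regNet_smul (c : ℂ) (T : Distr d) : regNet ρ χ (c • T) = c • regNet ρ χ T := by
  funext ε
  simp only [regNet, Pi.smul_apply]
  split_ifs
  · rfl
  · exact (smul_zero _).symm

theorem IsRegularization.contDiff {u : Net d} (hu : IsRegularization ρ χ T u)
    (h1 : ContDiff ℝ ∞ (u ⟨1, one_pos, le_rfl⟩)) (ε : I01) : ContDiff ℝ ∞ (u ε) := by
  rcases ε with ⟨ε, h0, hε⟩
  rcases hε.lt_or_eq with h | rfl
  · rw [hu ε h0 h]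
    exact contDiff_conv T _
  · exact h1

theorem IsRegularization.eventuallyEq_regNet {u : Net d} (hu : IsRegularization ρ χ T u) :
    u =ᶠ[toZero] regNet ρ χ T := by
  filter_upwards [eventually_lt_one_and_one_le_abs_log] with ε hε
  exact (hu ε ε.2.1 hε.1).trans (regNet_of_lt_one hε.1).symm

variable (ρ χ T) in
theorem isModerate_regNet : IsModerate (regNet ρ χ T) := by
  refine ⟨contDiff_regNet, fun l K => ?_⟩
  obtain ⟨R, hR⟩ := K.isCompact.isBounded.subset_ball 0
  obtain ⟨r, -, hr⟩ := exists_theta_eq_zero χ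
  obtain ⟨N, C, hC, hconv⟩ := exists_norm_iteratedFDeriv_conv_le T R r
  obtain ⟨A, hA, hθ⟩ := exists_norm_iteratedFDeriv_theta_le ρ χ (N + l)
  refine ⟨d + (N + l) + 1, pSemi_isLittleO_of_eventually_le
    (g := fun ε => C * (A * ((ε : ℝ) ^ (d + (N + l)))⁻¹)) ?_
    (((inv_pow_isLittleO_inv_pow (Nat.lt_succ_self _)).const_mul_left A).const_mul_left C)⟩
  filter_upwards [eventually_lt_one_and_one_le_abs_log] with ε hε
  have h0 := ε.2.1
  rw [regNet_of_lt_one hε.1]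
  exact pSemi_le K l (by positivity) fun n hn x hx => hconv _ (hr ρ _ hε.2) n _
    (fun k hk => hθ _ k (hk.trans (Nat.add_le_add_left hn N))) x (mem_ball_zero_iff.1 (hR hx))

theorem IsRegularization.isModerate {u : Net d} (hu : IsRegularization ρ χ T u)
    (h1 : ContDiff ℝ ∞ (u ⟨1, one_pos, le_rfl⟩)) : IsModerate u :=
  (isModerate_regNet ρ χ T).congr (hu.contDiff h1) hu.eventuallyEq_regNet

variable (ρ χ) in
/-- The embedding `ι_S : T ↦ [(T ∗ θ_ε)_ε]` of the distributions into the simplified Colombeau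
algebra. -/
def embedding : Distr d →ₗ[ℂ] G d where
  toFun T := G.mk (regNet ρ χ T) (isModerate_regNet ρ χ T)
  map_add' S T := congrArg (Ideal.Quotient.mk (Negligible d)) (Subtype.ext (regNet_add S T))
  map_smul' c T := congrArg (Ideal.Quotient.mk (Negligible d)) (Subtype.ext (regNet_smul c T))

theorem IsRegularization.embedding_eq {u : Net d} (hu : IsRegularization ρ χ T u)
    (hmod : u ∈ Moderate d) : embedding ρ χ T = G.mk u hmod :=
  mk_eq_mk_of_eventuallyEq _ hmod hu.eventuallyEq_regNet.symm

end Regularization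

section Smooth

variable {d : ℕ} {ρ : 𝓢(E d, ℂ)} {χ : 𝓓((⊤ : Opens (E d)), ℝ)}

theorem conv_ofSmooth (f : SmoothFun d) (θ : Test d) :
    conv (ofSmooth f) θ = fun y => ∫ x, θ x • (f : E d → ℂ) (y - x) := by
  funext y
  rw [conv, ofSmooth_apply, ← integral_sub_left_eq_self _ volume y]
  refine integral_congr_ae (Eventually.of_forall fun x => ?_)
  exact congrArg (fun z => θ z * (f : E d → ℂ) (y - x)) (sub_sub_cancel y x)

theorem iteratedFDeriv_conv_ofSmooth (f : SmoothFun d) (θ : Test d) (k : ℕ) (y : E d) :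
    iteratedFDeriv ℝ k (conv (ofSmooth f) θ) y =
      ∫ x, θ x • iteratedFDeriv ℝ k (f : E d → ℂ) (y - x) := by
  have hf : ContDiff ℝ ∞ (f : E d → ℂ) := f.2
  rw [conv_ofSmooth, iteratedFDeriv_integral_smul_sub θ.continuous θ.hasCompactSupport
    (hf.of_le (by exact_mod_cast le_top))]

theorem isNegligible_regNet_ofSmooth_sub (hρ : HasDiracMoments ρ) (hχ : ∀ᶠ x in 𝓝 0, χ x = 1)
    (f : SmoothFun d) : IsNegligible (regNet ρ χ (ofSmooth f) - fun _ => (f : E d → ℂ)) := by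
  have hf : ContDiff ℝ ∞ (f : E d → ℂ) := f.2
  refine ⟨fun ε => (contDiff_regNet ε).sub hf, fun l K p => ?_⟩
  obtain ⟨R, hR⟩ := K.isCompact.isBounded.subset_ball 0
  obtain ⟨r, C, hC, h⟩ := hρ.exists_norm_integral_theta_smul_sub_le hχ p
  set M := pSemi (compactBall d (R + r)) (p + 1 + l) (f : E d → ℂ)
  have hM : 0 ≤ M := pSemi_nonneg _ _ _
  refine pSemi_isLittleO_of_eventually_le (g := fun ε => C * M * (ε : ℝ) ^ (p + 1)) ?_
    ((pow_isLittleO_pow p.lt_succ_self).const_mul_left (C * M))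
  filter_upwards [eventually_lt_one_and_one_le_abs_log] with ε hε
  have h0 := ε.2.1
  refine pSemi_le K l (by positivity) fun k hk y hy => ?_
  have hk' : (k : WithTop ℕ∞) ≤ ∞ := by exact_mod_cast le_top
  have hsmooth : ContDiff ℝ (p + 1) (iteratedFDeriv ℝ k (f : E d → ℂ)) :=
    (hf.iteratedFDeriv_right (m := ∞) (by norm_cast)).of_le (by exact_mod_cast le_top)
  rw [Pi.sub_apply, regNet_of_lt_one hε.1, iteratedFDeriv_sub_apply
    ((contDiff_conv _ _).of_le hk').contDiffAt (hf.of_le hk').contDiffAt,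
    iteratedFDeriv_conv_ofSmooth]
  refine h hsmooth (fun j hj x hx => ?_) hε.2
  rw [norm_iteratedFDeriv_iteratedFDeriv]
  refine le_pSemi _ _ hf (by omega) (mem_closedBall_zero_iff.2 ((norm_add_le y x).trans ?_))
  exact add_le_add (mem_ball_zero_iff.1 (hR hy)).le hx

theorem embedding_ofSmooth (hρ : HasDiracMoments ρ) (hχ : ∀ᶠ x in 𝓝 0, χ x = 1)
    (f : SmoothFun d) : embedding ρ χ (ofSmooth f) = sigma f :=
  (mk_eq_mk_iff _ _).2 (isNegligible_regNet_ofSmooth_sub hρ hχ f)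

end Smooth

section Injective

variable {d : ℕ} {ρ : 𝓢(E d, ℂ)} {χ : 𝓓((⊤ : Opens (E d)), ℝ)}

theorem integrable_smul_jets_reflect (φ θ : Test d) (N : ℕ) :
    Integrable fun y => φ y • jets N (reflect θ y) :=
  (φ.continuous.smul (contDiff_jets_reflect N θ).continuous).integrable_of_hasCompactSupport
    φ.hasCompactSupport.smul_right

theorem exists_integral_smul_conv_eq_clm_jets (T : Distr d) (φ : Test d) {r : ℝ} (hr : 0 ≤ r) :
    ∃ (N : ℕ) (L : (∀ k : Fin N, E d →ᵇ E d [×(k : ℕ)]→L[ℝ] ℂ) →L[ℂ] ℂ),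
      T φ = L (jets N φ) ∧ ∀ θ : Test d, (∀ x, r ≤ ‖x‖ → θ x = 0) →
        ∫ y, φ y • conv T θ y = L (∫ y, φ y • jets N (reflect θ y)) := by
  obtain ⟨R, hR⟩ := exists_forall_eq_zero φ
  obtain ⟨N, L, hL⟩ := exists_eq_clm_jets T (compactBall d (R + r))
  refine ⟨N, L, hL φ (Function.support_subset_iff'.2 fun x hx => hR x ?_), fun θ hθ => ?_⟩
  · have hx : ¬‖x‖ ≤ R + r := fun h => hx (mem_closedBall_zero_iff.2 h)
    linarith
  rw [← L.integral_comp_comm (integrable_smul_jets_reflect φ θ N)]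
  refine integral_congr_ae (Eventually.of_forall fun y => ?_)
  change φ y • T (reflect θ y) = L (φ y • jets N (reflect θ y))
  rw [map_smul]
  rcases le_or_gt R ‖y‖ with hy | hy
  · rw [hR y hy, zero_smul, zero_smul]
  · rw [hL _ (support_reflect_subset hθ hy.le)]

/-- Both sides are the derivative of order `k` at `x` of `x ↦ ∫ y, φ y * θ (y - x)`, whose
derivatives may fall on either factor. -/
theorem integral_smul_iteratedFDeriv_reflect (φ θ : Test d) (k : ℕ) (x : E d) :
    ∫ y, φ y • iteratedFDeriv ℝ k (reflect θ y) x =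
      ∫ u, θ u • iteratedFDeriv ℝ k φ (x + u) := by
  have hk : (k : WithTop ℕ∞) ≤ ∞ := by exact_mod_cast le_top
  have hshift : ∀ y, iteratedFDeriv ℝ k (reflect θ y) x =
      iteratedFDeriv ℝ k (reflect θ 0) (x - y) := fun y => by
    rw [← iteratedFDeriv_comp_sub]
    exact congrArg (iteratedFDeriv ℝ k · x) (funext fun z =>
      congrArg θ (by rw [zero_sub, neg_sub]))
  have hcomm : (fun x => ∫ y, φ y • reflect θ 0 (x - y)) =
      fun x => ∫ u, reflect θ 0 u • φ (x - u) := funext fun x => by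
    rw [← integral_sub_left_eq_self _ volume x]
    simp only [sub_sub_cancel, smul_eq_mul, mul_comm]
  calc ∫ y, φ y • iteratedFDeriv ℝ k (reflect θ y) x
      = ∫ y, φ y • iteratedFDeriv ℝ k (reflect θ 0) (x - y) := by
        simp only [hshift]
    _ = iteratedFDeriv ℝ k (fun x => ∫ y, φ y • reflect θ 0 (x - y)) x :=
        (congrFun (iteratedFDeriv_integral_smul_sub φ.continuous φ.hasCompactSupport
          ((reflect θ 0).contDiff.of_le hk)) x).symm
    _ = ∫ u, reflect θ 0 u • iteratedFDeriv ℝ k φ (x - u) := by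
        rw [hcomm, iteratedFDeriv_integral_smul_sub (reflect θ 0).continuous
          (reflect θ 0).hasCompactSupport (φ.contDiff.of_le hk)]
    _ = ∫ u, θ u • iteratedFDeriv ℝ k φ (x + u) := by
        rw [← integral_neg_eq_self]
        refine integral_congr_ae (Eventually.of_forall fun u => ?_)
        have hu : reflect θ 0 (-u) = θ u := congrArg θ (by rw [zero_sub, neg_neg])
        simp only [hu, sub_neg_eq_add]

theorem integral_smul_jets_reflect_apply (φ θ : Test d) {N : ℕ} (k : Fin N) (x : E d) :
    (∫ y, φ y • jets N (reflect θ y)) k x = ∫ u, θ u • iteratedFDeriv ℝ k φ (x + u) := by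
  have heval := ((BoundedContinuousFunction.evalCLM ℂ x).comp (ContinuousLinearMap.proj
    (φ := fun k : Fin N => E d →ᵇ E d [×(k : ℕ)]→L[ℝ] ℂ) k)).integral_comp_comm
    (integrable_smul_jets_reflect φ θ N)
  exact heval.symm.trans (integral_smul_iteratedFDeriv_reflect φ θ k x)

theorem exists_norm_integral_smul_jets_reflect_sub_le (hρ : HasDiracMoments ρ)
    (hχ : ∀ᶠ x in 𝓝 0, χ x = 1) (φ : Test d) (N : ℕ) :
    ∃ C : ℝ, ∀ ε : Set.Ioo (0 : ℝ) 1, 1 ≤ |Real.log ε| →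
      ‖(∫ y, φ y • jets N (reflect (theta ρ χ ε) y)) - jets N φ‖ ≤ C * ε := by
  obtain ⟨R, C, hC, h⟩ := hρ.exists_norm_integral_theta_smul_sub_le hχ 0
  obtain ⟨M, hM⟩ :=
    exists_forall_norm_iteratedFDeriv_le (φ.hasCompactSupport.toSchwartzMap φ.contDiff) (N + 1)
  have hM0 : 0 ≤ M := (norm_nonneg _).trans (hM 0 (Nat.zero_le _) 0)
  refine ⟨C * M, fun ε hε => ?_⟩
  have h0 := ε.2.1
  refine (pi_norm_le_iff_of_nonneg (by positivity)).2 fun k =>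
    (BoundedContinuousFunction.norm_le (by positivity)).2 fun x => ?_
  have hφ : ContDiff ℝ ∞ (iteratedFDeriv ℝ k φ) := φ.contDiff.iteratedFDeriv_right (by norm_cast)
  have hG : ContDiff ℝ ((0 : ℕ) + 1) fun z => iteratedFDeriv ℝ k φ (x - z) :=
    (hφ.comp (contDiff_const.sub contDiff_id)).of_le (by exact_mod_cast le_top)
  have hest := h hG (y := 0) (M := M) (fun j hj z _ => ?_) hε
  · simp only [zero_sub, sub_neg_eq_add, sub_zero, zero_add, pow_one] at hest
    rwa [Pi.sub_apply, BoundedContinuousFunction.sub_apply, integral_smul_jets_reflect_apply,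
      jets_apply]
  · rw [iteratedFDeriv_comp_sub_left (hφ.of_le (by exact_mod_cast le_top)), norm_smul, norm_pow,
      norm_neg, norm_one, one_pow, one_mul, norm_iteratedFDeriv_iteratedFDeriv]
    exact hM (j + k) (by omega) _

theorem tendsto_integral_smul_regNet (hρ : HasDiracMoments ρ) (hχ : ∀ᶠ x in 𝓝 0, χ x = 1)
    (T : Distr d) (φ : Test d) :
    Tendsto (fun ε => ∫ y, φ y • regNet ρ χ T ε y) toZero (𝓝 (T φ)) := by
  obtain ⟨r, hr0, hr⟩ := exists_theta_eq_zero χ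
  obtain ⟨N, L, hTφ, hL⟩ := exists_integral_smul_conv_eq_clm_jets T φ hr0
  obtain ⟨C, hC⟩ := exists_norm_integral_smul_jets_reflect_sub_le hρ hχ φ N
  rw [tendsto_iff_norm_sub_tendsto_zero]
  refine squeeze_zero' (g := fun ε : I01 => ‖L‖ * (C * ε))
    (Eventually.of_forall fun ε => norm_nonneg _) ?_ ?_
  · filter_upwards [eventually_lt_one_and_one_le_abs_log] with ε hε
    rw [regNet_of_lt_one hε.1, hL _ (hr ρ _ hε.2), hTφ, ← map_sub]
    exact L.le_opNorm_of_le (hC _ hε.2)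
  · simpa only [mul_zero] using (tendsto_toZero.const_mul C).const_mul ‖L‖

theorem injective_embedding (hρ : HasDiracMoments ρ) (hχ : ∀ᶠ x in 𝓝 0, χ x = 1) :
    Function.Injective (embedding ρ χ) := by
  refine (injective_iff_map_eq_zero _).2 fun T hT => ContinuousLinearMap.ext fun φ => ?_
  have hnegl : IsNegligible (regNet ρ χ T) := Ideal.Quotient.eq_zero_iff_mem.1 hT
  exact tendsto_nhds_unique (tendsto_integral_smul_regNet hρ hχ T φ)
    (hnegl.tendsto_integral_smul φ)

end Injective

end Colombeau

end

theorem mainTheorem3_general (d : ℕ)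
    (ρ : 𝓢(Colombeau.E d, ℂ))
    (hρ_int : ∫ x, ρ x = 1)
    (hρ_mom : ∀ m : Fin d → ℕ, m ≠ 0 → ∫ x, ((∏ i, x i ^ m i : ℝ) : ℂ) * ρ x = 0)
    (χ : 𝓓((⊤ : Opens (Colombeau.E d)), ℝ))
    (hχ : ∀ᶠ x in 𝓝 0, χ x = 1) :
    ∃ ι : Colombeau.Distr d →ₗ[ℂ] Colombeau.G d,
      (∀ (T : Colombeau.Distr d) (u : Colombeau.Net d),
        (∀ (ε : ℝ) (h0 : 0 < ε) (h1 : ε < 1),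
          u ⟨ε, h0, h1.le⟩ = Colombeau.conv T (Colombeau.theta ρ χ ⟨ε, h0, h1⟩)) →
        ContDiff ℝ ∞ (u ⟨1, one_pos, le_rfl⟩) →
        ∃ hu : u ∈ Colombeau.Moderate d, ι T = Colombeau.G.mk u hu) ∧
      Function.Injective ι ∧
      ∀ f : Colombeau.SmoothFun d, ι (Colombeau.ofSmooth f) = Colombeau.sigma f := by
  have hρ : Colombeau.HasDiracMoments ρ := ⟨hρ_int, hρ_mom⟩
  refine ⟨Colombeau.embedding ρ χ, fun T u hu h1 => ?_, Colombeau.injective_embedding hρ hχ,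
    Colombeau.embedding_ofSmooth hρ hχ⟩
  have hreg : Colombeau.IsRegularization ρ χ T u := hu
  exact ⟨hreg.isModerate h1, hreg.embedding_eq (hreg.isModerate h1)⟩

theorem mainTheorem3 (d : ℕ)
    (ρ : 𝓢(Colombeau.E d, ℂ))
    (hρ_even : ∀ x, ρ (-x) = ρ x)
    (hρ_int : ∫ x, ρ x = 1)
    (hρ_mom : ∀ m : Fin d → ℕ, m ≠ 0 → ∫ x, ((∏ i, x i ^ m i : ℝ) : ℂ) * ρ x = 0)
    (χ : 𝓓((⊤ : Opens (Colombeau.E d)), ℝ))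
    (hχ_range : ∀ x, 0 ≤ χ x ∧ χ x ≤ 1)
    (hχ_one : ∀ x ∈ Metric.closedBall (0 : Colombeau.E d) 1, χ x = 1)
    (hχ_zero : ∀ x ∉ Metric.ball (0 : Colombeau.E d) 2, χ x = 0) :
    ∃ ι : Colombeau.Distr d →ₗ[ℂ] Colombeau.G d,
      -- the net `(T ∗ θ_ε)_ε`, completed by any smooth function at `ε = 1`, is a moderate net of
      -- smooth functions, and its class is `ι T`
      (∀ (T : Colombeau.Distr d) (u : Colombeau.Net d),
        (∀ (ε : ℝ) (h0 : 0 < ε) (h1 : ε < 1),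
          u ⟨ε, h0, h1.le⟩ = Colombeau.conv T (Colombeau.theta ρ χ ⟨ε, h0, h1⟩)) →
        ContDiff ℝ ∞ (u ⟨1, one_pos, le_rfl⟩) →
        ∃ hu : u ∈ Colombeau.Moderate d, ι T = Colombeau.G.mk u hu) ∧
      Function.Injective ι ∧
      ∀ f : Colombeau.SmoothFun d, ι (Colombeau.ofSmooth f) = Colombeau.sigma f :=
  mainTheorem3_general d ρ hρ_int hρ_mom χ
    (eventually_of_mem (Metric.closedBall_mem_nhds 0 one_pos) hχ_one)
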